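/- **Conventions.** An *association scheme* of size $d$ on a nonempty finite set $X$ is a partition $S=\{R_0,\dots,R_d\}$ of $X\times X$ into nonempty relations such that $R_0=\{(x,x)\mid x\in X\}$; for each $i$ there is an index $i'$ with $R_{i'}=\{(x,y)\mid (y,x)\in R_i\}$; and for all $i,j,\ell$ the number $p_{ij}^\ell=|\{z\in X\mid (x,z)\in R_i,\ (z,y)\in R_j\}|$ does not depend on the choice of $(x,y)\in R_\ell$. The *valency* of $R_i$ is $k_i=p_{ii'}^0$, and $S$ is *quasi-thin* if $k_i\le 2$ for all $i$. For indices $i,j$ put $R_iR_j=\{R_\ell\mid p_{ij}^\ell>0\}$. Let $\mathcal A_2=\{i\mid k_i=2\}$. A pair $(i_0,\ell_n)$ of indices is a *bad pair* if $|R_{i_0'}R_{\ell_n}|=1$ and there are $n\in\mathbb N$ and indices $i_b,j_b,\ell_b$ $(0\le b\le n)$, beginning with the given $i_0$ and ending with the given $\ell_n$, such that $k_{i_b}=k_{\ell_b}=2$ and $p_{i_bj_b}^{\ell_b}=1$ for $0\le b\le n$, and $\ell_c=i_{c+1}$ for $0\le c<n$. On $\mathcal A_2$ write $i\sim j$ if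 $|R_{i'}R_j|=2$ or $(i,j)$ is a bad pair; this is an equivalence relation. For a field $R$ and $x\in X$, the *Terwilliger algebra* $\mathcal T=\mathcal T_R(x)$ of $S$ is the $R$-subalgebra of the matrix algebra $M_X(R)$ generated by the adjacency matrices $A_i$ of $R_i$ (with $(y,z)$-entry $1$ if $(y,z)\in R_i$ and $0$ otherwise) and the diagonal matrices $E_i^*(x)=\sum_{y:\,(x,y)\in R_i}E_{yy}$, $0\le i\le d$. The *dominant dimension* $\mathrm{domdim}(A)$ of a finite-dimensional algebra $A$ is the least $n\ge 0$ such that the term $I_n$ in a minimal injective resolution $0\to {}_AA\to I_0\to I_1\to\cdots$ of the left regular module is not projective, and $\infty$ if all $I_n$ are projective. **Corollary 2.12.** Let $R$ be a field of characteristic $p\ge 0$, let $S$ be a quasi-thin association scheme on a finite set $X$, let $x\in X$, and let $r\ge 0$ be the number of equivalence classes of $\sim$ on $\mathcal A_2$. Then $$\mathrm{domdim}(\mathcal T_R(x))=\begin{cases}0,&\text{if }p=2\text{ and }r\ge 2,\\ 2,&\text{if }p=2\text{ and }r=1,\\ \infty,&\text{otherwise.}\end{cases}$$ -/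

import Mathlib

/-- An association scheme of size `d` on the (nonempty, finite) set `X`: a partition of `X × X`
into `d + 1` nonempty relations `R₀, …, R_d` such that `R₀` is the diagonal, the transpose of each
relation is again one of the relations, and the number of `z` with `(x, z) ∈ Rᵢ`, `(z, y) ∈ Rⱼ`
depends only on the relation containing `(x, y)`. Here `rel i x y` means `(x, y) ∈ Rᵢ`. -/
structure AssociationScheme (X : Type*) [Fintype X] (d : ℕ) where
  rel : Fin (d + 1) → X → X → Prop
  rel_nonempty : ∀ i, ∃ x y, rel i x y
  existsUnique_rel : ∀ x y, ∃! i, rel i x y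
  rel_zero : ∀ x y, rel 0 x y ↔ x = y
  exists_transpose : ∀ i, ∃ i', ∀ x y, rel i' x y ↔ rel i y x
  ncard_eq : ∀ i j l x y u v, rel l x y → rel l u v →
    {z | rel i x z ∧ rel j z y}.ncard = {w | rel i u w ∧ rel j w v}.ncard

namespace AssociationScheme

/-- The index `i'` of the transpose of the relation `Rᵢ`. -/
noncomputable def transpose {X : Type*} [Fintype X] {d : ℕ} (S : AssociationScheme X d)
    (i : Fin (d + 1)) : Fin (d + 1) :=
  (S.exists_transpose i).choose

/-- The intersection number `p_{ij}^l`, computed at an arbitrary pair in `R_l`. -/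
noncomputable def intersectionNumber {X : Type*} [Fintype X] {d : ℕ} (S : AssociationScheme X d)
    (i j l : Fin (d + 1)) : ℕ :=
  {z | S.rel i (S.rel_nonempty l).choose z ∧
    S.rel j z (S.rel_nonempty l).choose_spec.choose}.ncard

/-- The valency `kᵢ = p_{i i'}^0`. -/
noncomputable def valency {X : Type*} [Fintype X] {d : ℕ} (S : AssociationScheme X d)
    (i : Fin (d + 1)) : ℕ :=
  S.intersectionNumber i (S.transpose i) 0

/-- A scheme is quasi-thin if all its valencies are at most `2`. -/
def IsQuasiThin {X : Type*} [Fintype X] {d : ℕ} (S : AssociationScheme X d) : Prop :=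
  ∀ i, S.valency i ≤ 2

/-- The product `Rᵢ Rⱼ`, as the set of indices `l` with `p_{ij}^l > 0`. -/
def relProduct {X : Type*} [Fintype X] {d : ℕ} (S : AssociationScheme X d)
    (i j : Fin (d + 1)) : Set (Fin (d + 1)) :=
  {l | 0 < S.intersectionNumber i j l}

/-- Bad pairs: `(a, b)` is a bad pair if `|R_{a'} R_b| = 1` and there are `n` and indices
`i_c, j_c, l_c` (`0 ≤ c ≤ n`) with `i_0 = a`, `l_n = b`, `l_c = i_{c+1}` for `c < n`, and
`k_{i_c} = k_{l_c} = 2`, `p_{i_c j_c}^{l_c} = 1` for all `c ≤ n`. -/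
def IsBadPair {X : Type*} [Fintype X] {d : ℕ} (S : AssociationScheme X d)
    (a b : Fin (d + 1)) : Prop :=
  ∃ (n : ℕ) (i j l : Fin (n + 1) → Fin (d + 1)),
    (∀ c, S.valency (i c) = 2 ∧ S.valency (l c) = 2 ∧
      S.intersectionNumber (i c) (j c) (l c) = 1) ∧
    (S.relProduct (S.transpose (i 0)) (l (Fin.last n))).ncard = 1 ∧
    (∀ c : Fin n, l c.castSucc = i c.succ) ∧
    i 0 = a ∧ l (Fin.last n) = b

/-- The set `𝒜₂` of indices of valency `2`. -/
abbrev A₂ {X : Type*} [Fintype X] {d : ℕ} (S : AssociationScheme X d) : Type :=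
  {i : Fin (d + 1) // S.valency i = 2}

/-- The relation `∼` on `𝒜₂`: `i ∼ j` if `|R_{i'} R_j| = 2` or `(i, j)` is a bad pair. -/
def Equiv₂ {X : Type*} [Fintype X] {d : ℕ} (S : AssociationScheme X d) (i j : S.A₂) : Prop :=
  (S.relProduct (S.transpose i) j).ncard = 2 ∨ S.IsBadPair i j

/-! ### The relation `∼` is an equivalence relation -/

theorem rel_transpose {X : Type*} [Fintype X] {d : ℕ} (S : AssociationScheme X d)
    (i : Fin (d + 1)) (x y : X) : S.rel (S.transpose i) x y ↔ S.rel i y x :=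
  (S.exists_transpose i).choose_spec x y

theorem rel_unique {X : Type*} [Fintype X] {d : ℕ} (S : AssociationScheme X d)
    {i j : Fin (d + 1)} {x y : X} (hi : S.rel i x y) (hj : S.rel j x y) : i = j :=
  (S.existsUnique_rel x y).unique hi hj

theorem transpose_transpose {X : Type*} [Fintype X] {d : ℕ} (S : AssociationScheme X d)
    (i : Fin (d + 1)) : S.transpose (S.transpose i) = i := by
  obtain ⟨x, y, h⟩ := S.rel_nonempty i
  exact S.rel_unique (by rw [rel_transpose, rel_transpose]; exact h) h

theorem intersectionNumber_eq {X : Type*} [Fintype X] {d : ℕ} (S : AssociationScheme X d)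
    (i j : Fin (d + 1)) {l : Fin (d + 1)} {x y : X} (h : S.rel l x y) :
    S.intersectionNumber i j l = {z | S.rel i x z ∧ S.rel j z y}.ncard :=
  S.ncard_eq _ _ _ _ _ _ _ (S.rel_nonempty l).choose_spec.choose_spec h

theorem valency_eq {X : Type*} [Fintype X] {d : ℕ} (S : AssociationScheme X d)
    (i : Fin (d + 1)) (x : X) : S.valency i = {y | S.rel i x y}.ncard := by
  rw [valency, S.intersectionNumber_eq i _ ((S.rel_zero x x).2 rfl)]
  congr 1
  ext z
  simp [rel_transpose]

theorem intersectionNumber_pos {X : Type*} [Fintype X] {d : ℕ} (S : AssociationScheme X d)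
    (i j l : Fin (d + 1)) :
    0 < S.intersectionNumber i j l ↔ ∃ x y z, S.rel l x y ∧ S.rel i x z ∧ S.rel j z y := by
  constructor
  · intro h
    obtain ⟨x, y, hxy⟩ := S.rel_nonempty l
    rw [S.intersectionNumber_eq i j hxy, Set.ncard_pos] at h
    obtain ⟨z, hz⟩ := h
    exact ⟨x, y, z, hxy, hz⟩
  · rintro ⟨x, y, z, hxy, hz⟩
    rw [S.intersectionNumber_eq i j hxy, Set.ncard_pos]
    exact ⟨z, hz⟩

theorem mem_relProduct_transpose {X : Type*} [Fintype X] {d : ℕ} (S : AssociationScheme X d)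
    (i j l : Fin (d + 1)) :
    l ∈ S.relProduct (S.transpose i) j ↔ 0 < S.intersectionNumber i l j := by
  simp only [relProduct, Set.mem_ofPred_eq, intersectionNumber_pos, rel_transpose]
  constructor
  · rintro ⟨x, y, z, h⟩
    exact ⟨z, y, x, h.2.2, h.2.1, h.1⟩
  · rintro ⟨x, y, z, h⟩
    exact ⟨z, y, x, h.2.2, h.2.1, h.1⟩

theorem ncard_relProduct_symm {X : Type*} [Fintype X] {d : ℕ} (S : AssociationScheme X d)
    (i j : Fin (d + 1)) :
    (S.relProduct (S.transpose i) j).ncard = (S.relProduct (S.transpose j) i).ncard := by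
  have key : ∀ i j l, l ∈ S.relProduct (S.transpose i) j →
      S.transpose l ∈ S.relProduct (S.transpose j) i := by
    intro i j l h
    simp only [relProduct, Set.mem_ofPred_eq, intersectionNumber_pos, rel_transpose] at h ⊢
    obtain ⟨x, y, z, h1, h2, h3⟩ := h
    exact ⟨y, x, z, h1, h3, h2⟩
  refine Set.ncard_congr (fun l _ => S.transpose l) (key i j) ?_ ?_
  · intro a b _ _ hab
    rw [← S.transpose_transpose a, hab, S.transpose_transpose]
  · intro b hb
    exact ⟨S.transpose b, key j i b hb, S.transpose_transpose b⟩

theorem sum_intersectionNumber {X : Type*} [Fintype X] {d : ℕ} (S : AssociationScheme X d)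
    (i j : Fin (d + 1)) : ∑ l, S.intersectionNumber i l j = S.valency i := by
  classical
  obtain ⟨x, y, hxy⟩ := S.rel_nonempty j
  rw [S.valency_eq i x, Set.ncard_eq_toFinset_card' {z | S.rel i x z},
    Finset.card_eq_sum_card_fiberwise (t := Finset.univ)
      (f := fun z => (S.existsUnique_rel z y).choose) (by simp)]
  refine Finset.sum_congr rfl fun l _ => ?_
  rw [S.intersectionNumber_eq i l hxy, Set.ncard_eq_toFinset_card']
  congr 1
  ext z
  simp only [Set.mem_toFinset, Set.mem_ofPred_eq, Finset.mem_filter, and_congr_right_iff]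
  intro _
  have hs := (S.existsUnique_rel z y).choose_spec.1
  constructor
  · intro h
    exact S.rel_unique hs h
  · intro h
    rw [← h]
    exact hs

theorem ncard_relProduct_spec {X : Type*} [Fintype X] {d : ℕ} (S : AssociationScheme X d)
    {i : Fin (d + 1)} (hi : S.valency i = 2) (j : Fin (d + 1)) :
    ((S.relProduct (S.transpose i) j).ncard = 1 ∨ (S.relProduct (S.transpose i) j).ncard = 2) ∧
    ((S.relProduct (S.transpose i) j).ncard = 2 ↔ ∃ l, S.intersectionNumber i l j = 1) := by
  classical
  have hs := S.sum_intersectionNumber i j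
  rw [hi] at hs
  have hc : (S.relProduct (S.transpose i) j).ncard =
      (Finset.univ.filter fun l => 0 < S.intersectionNumber i l j).card := by
    rw [← Set.ncard_coe_finset]
    congr 1
    ext l
    simp [mem_relProduct_transpose]
  rw [hc]
  set f := fun l => S.intersectionNumber i l j with hf
  set s := Finset.univ.filter fun l => 0 < f l with hsdef
  have hs' : ∑ l ∈ s, f l = 2 := by
    rw [← hs]
    refine Finset.sum_subset (Finset.subset_univ _) fun l _ hl => ?_
    have : ¬ 0 < f l := fun h => hl (by simp [hsdef, h])
    omega
  have hle : s.card ≤ 2 := by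
    rw [← hs', Finset.card_eq_sum_ones]
    refine Finset.sum_le_sum fun l hl => ?_
    exact (Finset.mem_filter.1 hl).2
  have hpos : s.card ≠ 0 := by
    intro h0
    rw [Finset.card_eq_zero] at h0
    rw [h0] at hs'
    simp at hs'
  refine ⟨by omega, ?_, ?_⟩
  · intro h2
    obtain ⟨a, b, hab, hs2⟩ := Finset.card_eq_two.1 h2
    rw [hs2, Finset.sum_pair hab] at hs'
    have has : a ∈ s := by rw [hs2]; simp
    have hbs : b ∈ s := by rw [hs2]; simp
    have ha : 0 < f a := (Finset.mem_filter.1 has).2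
    have hb : 0 < f b := (Finset.mem_filter.1 hbs).2
    exact ⟨a, by change f a = 1; omega⟩
  · rintro ⟨l, hl⟩
    by_contra hne
    obtain ⟨a, ha⟩ := Finset.card_eq_one.1 (by omega : s.card = 1)
    have hls : l ∈ s := by
      simp only [hsdef, Finset.mem_filter, Finset.mem_univ, true_and]
      change 0 < S.intersectionNumber i l j
      omega
    rw [ha, Finset.mem_singleton] at hls
    rw [ha, Finset.sum_singleton, ← hls] at hs'
    have : f l = 1 := hl
    omega

/-- The relation `∼` is the transitive closure of the relation `|R_{i'} R_j| = 2` on `𝒜₂`. -/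
theorem equiv₂_iff_transGen {X : Type*} [Fintype X] {d : ℕ} (S : AssociationScheme X d)
    (a b : S.A₂) : S.Equiv₂ a b ↔
      Relation.TransGen (fun i j : S.A₂ => (S.relProduct (S.transpose i) j).ncard = 2) a b := by
  constructor
  · rintro (h | ⟨n, i, j, l, h1, -, h3, h4, h5⟩)
    · exact Relation.TransGen.single h
    · have key : ∀ (m : ℕ) (hm : m < n + 1),
          Relation.TransGen (fun i j : S.A₂ => (S.relProduct (S.transpose i) j).ncard = 2)
            a ⟨l ⟨m, hm⟩, (h1 _).2.1⟩ := by
        intro m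
        induction m with
        | zero =>
          intro hm
          refine Relation.TransGen.single ?_
          have := ((S.ncard_relProduct_spec (h1 0).1 (l 0)).2).2 ⟨j 0, (h1 0).2.2⟩
          rw [h4] at this
          exact this
        | succ m ih =>
          intro hm
          refine Relation.TransGen.tail (ih (by omega)) ?_
          have e : l ⟨m, by omega⟩ = i ⟨m + 1, hm⟩ := h3 ⟨m, by omega⟩
          change (S.relProduct (S.transpose (l ⟨m, by omega⟩)) (l ⟨m + 1, hm⟩)).ncard = 2
          rw [e]
          exact ((S.ncard_relProduct_spec (h1 ⟨m + 1, hm⟩).1 _).2).2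
            ⟨j ⟨m + 1, hm⟩, (h1 ⟨m + 1, hm⟩).2.2⟩
      have hb : (⟨l ⟨n, by omega⟩, (h1 _).2.1⟩ : S.A₂) = b := Subtype.ext h5
      rw [← hb]
      exact key n (by omega)
  · intro h
    rcases (S.ncard_relProduct_spec a.2 b).1 with hab | hab
    swap
    · exact Or.inl hab
    right
    suffices ∃ (n : ℕ) (i j l : Fin (n + 1) → Fin (d + 1)),
        (∀ c, S.valency (i c) = 2 ∧ S.valency (l c) = 2 ∧
          S.intersectionNumber (i c) (j c) (l c) = 1) ∧
        (∀ c : Fin n, l c.castSucc = i c.succ) ∧ i 0 = a ∧ l (Fin.last n) = b by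
      obtain ⟨n, i, j, l, h1, h2, h3, h4⟩ := this
      exact ⟨n, i, j, l, h1, by rw [h3, h4]; exact hab, h2, h3, h4⟩
    clear hab
    induction h with
    | @single b hb =>
      obtain ⟨j, hj⟩ := ((S.ncard_relProduct_spec a.2 b).2).1 hb
      exact ⟨0, fun _ => a, fun _ => j, fun _ => b, fun _ => ⟨a.2, b.2, hj⟩,
        fun c => c.elim0, rfl, rfl⟩
    | @tail b e _ hbe ih =>
      obtain ⟨n, i, j, l, h1, h2, h3, h4⟩ := ih
      obtain ⟨k, hk⟩ := ((S.ncard_relProduct_spec b.2 e).2).1 hbe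
      refine ⟨n + 1, Fin.snoc (α := fun _ => Fin (d + 1)) i b,
        Fin.snoc (α := fun _ => Fin (d + 1)) j k,
        Fin.snoc (α := fun _ => Fin (d + 1)) l e, ?_, ?_, ?_, ?_⟩
      · intro c
        refine Fin.lastCases ?_ (fun c => ?_) c
        · simpa using ⟨b.2, e.2, hk⟩
        · simpa using h1 c
      · intro c
        refine Fin.lastCases ?_ (fun c => ?_) c
        · rw [Fin.succ_last]
          simpa using h4
        · rw [Fin.succ_castSucc, Fin.snoc_castSucc, Fin.snoc_castSucc]
          exact h2 c
      · rw [← Fin.castSucc_zero]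
        simpa using h3
      · simp

theorem equivalence_equiv₂ {X : Type*} [Fintype X] {d : ℕ} (S : AssociationScheme X d) :
    Equivalence S.Equiv₂ := by
  have hsymm : ∀ i j : S.A₂, (S.relProduct (S.transpose i) j).ncard = 2 →
      (S.relProduct (S.transpose j) i).ncard = 2 := by
    intro i j h
    rw [S.ncard_relProduct_symm]
    exact h
  refine ⟨fun a => Or.inl ?_, fun {a b} h => ?_, fun {a b c} h h' => ?_⟩
  · refine ((S.ncard_relProduct_spec a.2 a).2).2 ⟨0, ?_⟩
    obtain ⟨x, y, hxy⟩ := S.rel_nonempty a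
    rw [S.intersectionNumber_eq _ _ hxy, Set.ncard_eq_one]
    refine ⟨y, ?_⟩
    ext z
    simp only [S.rel_zero, Set.mem_ofPred_eq, Set.mem_singleton_iff]
    exact ⟨fun h => h.2, fun h => ⟨h ▸ hxy, h⟩⟩
  · rw [equiv₂_iff_transGen] at h ⊢
    rw [← Relation.transGen_swap] at h
    exact Relation.TransGen.mono (fun i j hij => hsymm j i hij) _ _ h
  · rw [equiv₂_iff_transGen] at *
    exact h.trans h'

/-- The set `𝒜₂` with the equivalence relation `∼`. -/
def setoid₂ {X : Type*} [Fintype X] {d : ℕ} (S : AssociationScheme X d) : Setoid S.A₂ :=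
  ⟨S.Equiv₂, S.equivalence_equiv₂⟩

/-- The number `r` of equivalence classes of `∼` on `𝒜₂`. -/
noncomputable def numClasses {X : Type*} [Fintype X] {d : ℕ} (S : AssociationScheme X d) : ℕ :=
  Nat.card (Quotient S.setoid₂)

/-! ### The Terwilliger algebra -/

open Classical in
/-- The adjacency matrix `Aᵢ` of the relation `Rᵢ`. -/
noncomputable def adjMatrix {X : Type*} [Fintype X] {d : ℕ} (S : AssociationScheme X d)
    (R : Type*) [Field R] (i : Fin (d + 1)) : Matrix X X R :=
  Matrix.of fun y z => if S.rel i y z then 1 else 0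

open Classical in
/-- The dual idempotent `Eᵢ*(x) = ∑_{y ∈ x Rᵢ} E_{yy}`. -/
noncomputable def dualIdempotent {X : Type*} [Fintype X] [DecidableEq X] {d : ℕ}
    (S : AssociationScheme X d) (R : Type*) [Field R] (x : X) (i : Fin (d + 1)) :
    Matrix X X R :=
  ∑ y ∈ Finset.univ.filter (fun y => S.rel i x y), Matrix.single y y 1

/-- The Terwilliger algebra `𝒯_R(x)`: the (unital) subalgebra of the full matrix algebra generated
by all adjacency matrices and all dual idempotents with respect to `x`. -/
noncomputable def terwilligerAlgebra {X : Type*} [Fintype X] [DecidableEq X] {d : ℕ}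
    (S : AssociationScheme X d) (R : Type*) [Field R] (x : X) : Subalgebra R (Matrix X X R) :=
  Algebra.adjoin R (Set.range (S.adjMatrix R) ∪ Set.range (S.dualIdempotent R x))

end AssociationScheme

/-! ### Dominant dimension -/

/-- A submodule `N` of `M` is essential if it meets every nonzero submodule of `M`. -/
def Submodule.IsEssentialIn {A M : Type*} [Ring A] [AddCommGroup M] [Module A M]
    (N : Submodule A M) : Prop :=
  ∀ P : Submodule A M, N ⊓ P = ⊥ → P = ⊥

/-- A minimal injective resolution `0 → M → I₀ → I₁ → ⋯` of a left `A`-module `M`: an exact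
sequence with all `Iₙ` injective such that `I₀` is an injective envelope of `M` and `Iₙ₊₁` is an
injective envelope of the image of `Iₙ → Iₙ₊₁` (equivalently, of the cokernel of the map before). -/
structure MinimalInjectiveResolution.{u} (A : Type u) [Ring A] (M : Type u) [AddCommGroup M]
    [Module A M] where
  obj : ℕ → Type u
  [addCommGroup : ∀ n, AddCommGroup (obj n)]
  [module : ∀ n, Module A (obj n)]
  ι : M →ₗ[A] obj 0
  d : ∀ n, obj n →ₗ[A] obj (n + 1)
  injective_obj : ∀ n, Module.Injective A (obj n)
  injective_ι : Function.Injective ι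
  exact_zero : Function.Exact ι (d 0)
  exact_succ : ∀ n, Function.Exact (d n) (d (n + 1))
  essential_ι : (LinearMap.range ι).IsEssentialIn
  essential_d : ∀ n, (LinearMap.range (d n)).IsEssentialIn

attribute [instance] MinimalInjectiveResolution.addCommGroup MinimalInjectiveResolution.module

/-- The least `n` such that the `n`-th term of the resolution is not projective, and `∞` if all
terms are projective. -/
noncomputable def MinimalInjectiveResolution.firstNonprojective.{u} {A : Type u} [Ring A] {M : Type u}
    [AddCommGroup M] [Module A M] (I : MinimalInjectiveResolution A M) : ℕ∞ :=
  ⨅ (n : ℕ) (_ : ¬ Module.Projective A (I.obj n)), (n : ℕ∞)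

/-- The dominant dimension of `A` is `n`: the left regular module has a minimal injective
resolution, and in each such resolution `0 → A → I₀ → I₁ → ⋯` (they are all isomorphic) the least
index of a term that is not projective is `n` (with `n = ∞` if there is none). -/
def HasDominantDimension (A : Type*) [Ring A] (n : ℕ∞) : Prop :=
  Nonempty (MinimalInjectiveResolution A A) ∧
    ∀ I : MinimalInjectiveResolution A A, I.firstNonprojective = n

/-! ### Injective hulls and minimal injective resolutions -/

section Injective

universe u

variable {A : Type u} [Ring A]

/-! Let σ (`swap`) exchange the two points of each set xR_i with k_i = 2 and fix the other points;
in particular σ fixes x. By `mem_terwilligerAlgebra_iff`, the Terwilliger algebra A consists of the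
matrices invariant under σ acting on rows and columns at once and, at entries whose row and column
lie in different classes, under σ acting on rows alone. Hence only σ, the classes and the vanishing
of 2 in R matter.

If 2 ≠ 0 or σ = 1 (no classes), the trace form on A is nondegenerate, because all orbits of entries
have invertible size. So A is semisimple and every module is projective
(`isSemisimpleRing_of_swap`).

If 2 = 0 and there is one class, A is the centralizer of the permutation matrix of σ, that is, the
endomorphism ring of the permutation module of a group of order 2 having both a free and a trivial
summand. The full matrix module M is projective and injective over A, and 0 → A → M → M with m ↦ m +
σmσ is exact. This gives the first two terms; the third fails because the cokernel has a nonzero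
element that vanishes in every projective module (`HasDominantDimension.two_of_exact`).

If 2 = 0 and there are two classes, orbit columns u, v from different classes generate left ideals
that a homomorphism to A can treat independently, while v * a = 0 implies u * a = 0. In a projective
module the second property passes to elements, which is incompatible with extending that
homomorphism to an injective one (`HasDominantDimension.zero_of_mul`).

The definition of dominant dimension also asks for a minimal injective resolution, so injective
envelopes are built by Zorn's lemma. -/

theorem Module.Injective.of_retract {Q E : Type u} [AddCommGroup Q] [Module A Q] [AddCommGroup E]
    [Module A E] [Module.Injective A Q] (i : E →ₗ[A] Q) (r : Q →ₗ[A] E)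
    (hr : ∀ e, r (i e) = e) : Module.Injective A E where
  out X Y _ _ _ _ f hf g := by
    obtain ⟨h, hh⟩ := Module.Injective.out (R := A) f hf (i ∘ₗ g)
    exact ⟨r ∘ₗ h, fun x => by simp [hh, hr]⟩

theorem Module.Injective.exists_comp_eq {N I J : Type u} [AddCommGroup N] [Module A N]
    [AddCommGroup I] [Module A I] [AddCommGroup J] [Module A J] [Module.Injective A J]
    (d : N →ₗ[A] I) (f : N →ₗ[A] J) (h : LinearMap.ker d ≤ LinearMap.ker f) :
    ∃ s : I →ₗ[A] J, ∀ n, s (d n) = f n := by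
  obtain ⟨s, hs⟩ := Module.Injective.out (R := A) ((LinearMap.ker d).liftQ d le_rfl)
    (LinearMap.ker_eq_bot.1 (Submodule.ker_liftQ_eq_bot _ _ _ le_rfl))
    ((LinearMap.ker d).liftQ f h)
  exact ⟨s, fun n => by simpa using hs (Submodule.Quotient.mk n)⟩

theorem Submodule.IsEssentialIn.injective_of_comp {N I J : Type u} [AddCommGroup N] [Module A N]
    [AddCommGroup I] [Module A I] [AddCommGroup J] [Module A J]
    {d : N →ₗ[A] I} (hd : (LinearMap.range d).IsEssentialIn) {s : I →ₗ[A] J}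
    (h : ∀ n, s (d n) = 0 → d n = 0) : Function.Injective s := by
  rw [← LinearMap.ker_eq_bot]
  refine hd _ ?_
  rw [eq_bot_iff]
  rintro _ ⟨⟨n, rfl⟩, hx⟩
  exact h n hx

theorem Module.Injective.projective_of_injective {I J : Type u} [AddCommGroup I] [Module A I]
    [AddCommGroup J] [Module A J] [Module.Injective A I] [Module.Projective A J]
    (s : I →ₗ[A] J) (hs : Function.Injective s) : Module.Projective A I := by
  obtain ⟨t, ht⟩ := Module.Injective.out (R := A) s hs LinearMap.id
  exact Module.Projective.of_split s t (LinearMap.ext ht)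

/-- A projective module embeds in a free one, where the implication can be checked in each
coordinate. This is the obstruction to projectivity used in both characteristic 2 cases. -/
theorem Module.Projective.smul_eq_zero_of {P : Type*} [AddCommGroup P] [Module A P]
    [Module.Projective A P] {b c : A} (h : ∀ a, b * a = 0 → c * a = 0) {m : P}
    (hm : b • m = 0) : c • m = 0 := by
  obtain ⟨s, hs⟩ := ‹Module.Projective A P›
  rw [← hs (c • m), map_smul]
  have hb : b • s m = 0 := by rw [← map_smul, hm, map_zero]
  have : c • s m = 0 := by
    ext i
    exact h _ (by simpa using DFunLike.congr_fun hb i)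
  rw [this, map_zero]

theorem Submodule.exists_maximal_inf_eq_bot {Q : Type*} [AddCommGroup Q] [Module A Q]
    (E : Submodule A Q) : ∃ F : Submodule A Q, Maximal (fun F => E ⊓ F = ⊥) F := by
  suffices h : _ by
    obtain ⟨F, -, hF⟩ := zorn_le_nonempty₀ {F : Submodule A Q | E ⊓ F = ⊥} h ⊥ (by simp)
    exact ⟨F, hF⟩
  · intro c hc hchain y hy
    refine ⟨sSup c, ?_, fun z hz => le_sSup hz⟩
    rw [Set.mem_ofPred_eq, eq_bot_iff]
    rintro x ⟨hx, hx'⟩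
    obtain ⟨F, hF, hxF⟩ := (Submodule.mem_sSup_of_directed ⟨y, hy⟩ hchain.directedOn).1 hx'
    rw [← (hc hF : E ⊓ F = ⊥)]
    exact ⟨hx, hxF⟩

theorem Submodule.exists_maximal_essential {Q : Type*} [AddCommGroup Q] [Module A Q]
    (N : Submodule A Q) : ∃ E : Submodule A Q,
      Maximal (fun E => N ≤ E ∧ ∀ P ≤ E, N ⊓ P = ⊥ → P = ⊥) E := by
  suffices h : _ by
    obtain ⟨E, -, hE⟩ := zorn_le_nonempty₀
      {E : Submodule A Q | N ≤ E ∧ ∀ P ≤ E, N ⊓ P = ⊥ → P = ⊥} h N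
      ⟨le_rfl, fun P hP h => by rwa [inf_eq_right.2 hP] at h⟩
    exact ⟨E, hE⟩
  · intro c hc hchain y hy
    refine ⟨sSup c, ⟨(hc hy).1.trans (le_sSup hy), fun P hP h => ?_⟩, fun z hz => le_sSup hz⟩
    rw [eq_bot_iff]
    intro x hx
    obtain ⟨F, hF, hxF⟩ := (Submodule.mem_sSup_of_directed ⟨y, hy⟩ hchain.directedOn).1 (hP hx)
    -- Essentiality can be tested on cyclic submodules, and a single element of the union already
    -- lies in one member of the chain.
    have hspan := (hc hF).2 (Submodule.span A {x}) (by simpa using hxF) (by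
      rw [eq_bot_iff, ← h]
      exact inf_le_inf_left _ (by simpa using hx))
    rw [← hspan]
    exact Submodule.mem_span_singleton_self x

/-- With F a maximal complement of E in Q, the embedding E → Q/F lets the inclusion of E extend to
Q/F. The resulting map G : Q → Q is the identity on E and kills F; once its image is E, it is a
retraction from the injective module Q. -/
theorem Module.Injective.of_maximal_essential {Q : Type u} [AddCommGroup Q] [Module A Q]
    [Module.Injective A Q] {N E : Submodule A Q}
    (hE : Maximal (fun E => N ≤ E ∧ ∀ P ≤ E, N ⊓ P = ⊥ → P = ⊥) E) : Module.Injective A E := by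
  obtain ⟨F, hF⟩ := E.exists_maximal_inf_eq_bot
  obtain ⟨g, hg⟩ := Module.Injective.out (R := A) (F.mkQ ∘ₗ E.subtype) (by
    rw [← LinearMap.ker_eq_bot, eq_bot_iff]
    intro e he
    have : (e : Q) ∈ E ⊓ F := ⟨e.2, by simpa using he⟩
    rw [hF.1] at this
    simpa using this) E.subtype
  let G : Q →ₗ[A] Q := g ∘ₗ F.mkQ
  have hG : ∀ e ∈ E, G e = e := fun e he => hg ⟨e, he⟩
  have hFG : F ≤ LinearMap.ker G := fun q hq => by
    simp [G, (Submodule.Quotient.mk_eq_zero F).2 hq]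
  -- The image of G is still essential over N, so maximality of E applies: if P inside it misses N,
  -- it misses E, so the preimage of P misses E, lies in F by maximality of F, and is killed by G.
  have hrange : LinearMap.range G ≤ E := by
    refine hE.2 ⟨hE.1.1.trans fun e he => ⟨e, hG e he⟩, fun P hP hNP => ?_⟩
      (fun e he => ⟨e, hG e he⟩)
    have hEP : E ⊓ P = ⊥ := by
      refine hE.1.2 _ inf_le_left ?_
      rw [eq_bot_iff, ← hNP]
      exact inf_le_inf_left _ inf_le_right
    have hcomap : Submodule.comap G P ≤ F := by
      refine hF.2 ?_ fun q hq => ?_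
      · change E ⊓ Submodule.comap G P = ⊥
        rw [eq_bot_iff, ← hEP]
        rintro e ⟨he, he'⟩
        refine ⟨he, ?_⟩
        rw [← hG e he]
        exact he'
      · have : G q = 0 := hFG hq
        simp [this]
    rw [eq_bot_iff]
    intro p hp
    obtain ⟨q, rfl⟩ := hP hp
    exact hFG (hcomap hp)
  exact Module.Injective.of_retract E.subtype
    (G.codRestrict E fun q => hrange ⟨q, rfl⟩) fun e => Subtype.ext (hG e e.2)

variable (A) in
theorem exists_injective_embedding (M : Type u) [AddCommGroup M] [Module A M] :
    ∃ (Q : ModuleCat.{u} A) (f : M →ₗ[A] Q), Module.Injective A Q ∧ Function.Injective f := by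
  obtain ⟨J, hJ, f, hf⟩ :=
    (CategoryTheory.EnoughInjectives.presentation (ModuleCat.of A M)).some
  exact ⟨J, f.hom, Module.injective_module_of_injective_object A J,
    (ModuleCat.mono_iff_injective f).1 hf⟩

variable (A) in
/-- Every module has an injective envelope. -/
theorem exists_injective_hull (M : Type u) [AddCommGroup M] [Module A M] :
    ∃ (I : ModuleCat.{u} A) (f : M →ₗ[A] I), Module.Injective A I ∧ Function.Injective f ∧
      (LinearMap.range f).IsEssentialIn := by
  obtain ⟨Q, f, hQ, hf⟩ := exists_injective_embedding A M
  obtain ⟨E, hE⟩ := (LinearMap.range f).exists_maximal_essential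
  refine ⟨ModuleCat.of A E, f.codRestrict E fun m => hE.1.1 ⟨m, rfl⟩,
    Module.Injective.of_maximal_essential hE, fun a b h => hf (congrArg Subtype.val h),
    fun P hP => ?_⟩
  suffices h : Submodule.map E.subtype P = ⊥ by
    rw [eq_bot_iff]
    intro p hp
    have : (p : Q) ∈ Submodule.map E.subtype P := ⟨p, hp, rfl⟩
    rw [h] at this
    simpa using this
  refine hE.1.2 _ (Submodule.map_subtype_le E P) ?_
  rw [eq_bot_iff]
  rintro _ ⟨⟨m, rfl⟩, ⟨p, hp, hpm⟩⟩
  have : p ∈ LinearMap.range (f.codRestrict E fun m => hE.1.1 ⟨m, rfl⟩) ⊓ P :=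
    ⟨⟨m, Subtype.ext hpm.symm⟩, hp⟩
  rw [hP] at this
  rw [← hpm, (Submodule.mem_bot A).1 this]
  simp

/-- A module together with a submodule. -/
structure ModuleWithSubmodule (A : Type u) [Ring A] where
  carrier : ModuleCat.{u} A
  sub : Submodule A carrier

namespace ModuleWithSubmodule

/-- The map from a module to the injective envelope of its quotient. -/
noncomputable def toHull (s : ModuleWithSubmodule A) :
    s.carrier →ₗ[A] (exists_injective_hull A (s.carrier ⧸ s.sub)).choose :=
  (exists_injective_hull A (s.carrier ⧸ s.sub)).choose_spec.choose ∘ₗ s.sub.mkQ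

/-- The injective envelope of the quotient, with the image of the original module. -/
noncomputable def next (s : ModuleWithSubmodule A) : ModuleWithSubmodule A :=
  ⟨_, LinearMap.range s.toHull⟩

theorem ker_toHull (s : ModuleWithSubmodule A) : LinearMap.ker s.toHull = s.sub := by
  rw [toHull, LinearMap.ker_comp, LinearMap.ker_eq_bot.2
    (exists_injective_hull A (s.carrier ⧸ s.sub)).choose_spec.choose_spec.2.1]
  exact s.sub.ker_mkQ

theorem range_toHull_isEssentialIn (s : ModuleWithSubmodule A) :
    (LinearMap.range s.toHull).IsEssentialIn := by
  rw [toHull, LinearMap.range_comp, s.sub.range_mkQ, Submodule.map_top]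
  exact (exists_injective_hull A (s.carrier ⧸ s.sub)).choose_spec.choose_spec.2.2

theorem injective_next (s : ModuleWithSubmodule A) : Module.Injective A s.next.carrier :=
  (exists_injective_hull A (s.carrier ⧸ s.sub)).choose_spec.choose_spec.1

theorem exact_toHull (s : ModuleWithSubmodule A) {N : Type u} [AddCommGroup N] [Module A N]
    (f : N →ₗ[A] s.carrier) (h : LinearMap.range f = s.sub) : Function.Exact f s.toHull :=
  LinearMap.exact_iff.2 (s.ker_toHull.trans h.symm)

/-- The `n`-th iterate of `ModuleWithSubmodule.next`. -/
noncomputable def iter (s : ModuleWithSubmodule A) : ℕ → ModuleWithSubmodule A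
  | 0 => s
  | n + 1 => (s.iter n).next

end ModuleWithSubmodule

variable (A) in
theorem nonempty_minimalInjectiveResolution (M : Type u) [AddCommGroup M] [Module A M] :
    Nonempty (MinimalInjectiveResolution A M) := by
  obtain ⟨I, f, hI, hf, he⟩ := exists_injective_hull A M
  let s : ModuleWithSubmodule A := ⟨I, LinearMap.range f⟩
  exact ⟨{
    obj := fun n => (s.iter n).carrier
    ι := f
    d := fun n => (s.iter n).toHull
    injective_obj := fun n => match n with
      | 0 => hI
      | n + 1 => (s.iter n).injective_next
    injective_ι := hf
    exact_zero := s.exact_toHull f rfl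
    exact_succ := fun n => (s.iter n).next.exact_toHull (s.iter n).toHull rfl
    essential_ι := he
    essential_d := fun n => (s.iter n).range_toHull_isEssentialIn }⟩

end Injective

/-! ### Criteria for the dominant dimension -/

section DominantDimension

universe u

variable {A : Type u} [Ring A]

theorem HasDominantDimension.of_isSemisimpleRing [IsSemisimpleRing A] :
    HasDominantDimension A ⊤ := by
  refine ⟨nonempty_minimalInjectiveResolution A A, fun I => ?_⟩
  simp only [MinimalInjectiveResolution.firstNonprojective, iInf_eq_top]
  exact fun n hn => absurd (Module.projective_of_isSemisimpleRing A (I.obj n)) hn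

/-- No module containing `A` is both injective and projective if there is `u ≠ 0` in `A` and an
element `v` such that `u ↦ u`, `v ↦ 0` defines a homomorphism on the left ideal generated by `u`
and `v`, given by left multiplication with some `e`, while `v * a = 0` implies `u * a = 0`. -/
theorem HasDominantDimension.zero_of_mul {u v e : A} (hu : u ≠ 0) (heu : ∀ a, e * (a * u) = a * u)
    (hev : ∀ a, e * (a * v) = 0) (hvu : ∀ a, v * a = 0 → u * a = 0) :
    HasDominantDimension A 0 := by
  refine ⟨nonempty_minimalInjectiveResolution A A, fun I => ?_⟩
  have h0 : ¬ Module.Projective A (I.obj 0) := by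
    intro hproj
    have hlin : ∀ a, ∀ n ∈ Submodule.span A {u, v}, e * (a * n) = a * (e * n) := by
      intro a n hn
      obtain ⟨b, c, rfl⟩ := Submodule.mem_span_pair.1 hn
      have h1 := heu b
      have h2 := hev c
      have h3 := heu (a * b)
      have h4 := hev (a * c)
      simp only [smul_eq_mul, mul_add]
      rw [h1, h2, ← mul_assoc a b, ← mul_assoc a c, h3, h4]
      simp [mul_assoc]
    -- The homomorphism a * u + b * v ↦ a * u. Its extension h to A is right multiplication by m = h
    -- 1, so v • m = 0 while u • m = ι u ≠ 0.
    let f : Submodule.span A {u, v} →ₗ[A] A :=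
      { toFun := fun n => e * n
        map_add' := fun x y => by simp [mul_add]
        map_smul' := fun a n => hlin a n n.2 }
    have := I.injective_obj 0
    obtain ⟨h, hh⟩ := Module.Injective.out (R := A) (Submodule.span A {u, v}).subtype
      Subtype.val_injective (I.ι ∘ₗ f)
    have hval : ∀ n ∈ Submodule.span A {u, v}, n • h 1 = I.ι (e * n) := by
      intro n hn
      rw [← map_smul, smul_eq_mul, mul_one]
      exact hh ⟨n, hn⟩
    have hv0 : v • h 1 = 0 := by
      have := hev 1
      rw [one_mul] at this
      rw [hval v (Submodule.subset_span (by simp)), this, map_zero]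
    have hu0 := Module.Projective.smul_eq_zero_of hvu hv0
    have := heu 1
    rw [one_mul] at this
    rw [hval u (Submodule.subset_span (by simp)), this] at hu0
    exact hu (I.injective_ι (by rw [hu0, map_zero]))
  rw [MinimalInjectiveResolution.firstNonprojective]
  exact le_antisymm ((iInf₂_le 0 h0).trans (by simp)) (by simp)

/-- If `0 → A → M → M` is exact with `M` injective and projective, and the cokernel of
`M → M` has a nonzero element which is killed by all homomorphisms to projective modules, then
the dominant dimension of `A` is `2`. -/
theorem HasDominantDimension.two_of_exact {M : Type u} [AddCommGroup M] [Module A M]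
    [Module.Injective A M] [Module.Projective A M] (i : A →ₗ[A] M) (δ : M →ₗ[A] M)
    (hi : Function.Injective i) (hex : Function.Exact i δ) {b c : A} {z : M}
    (hz : z ∉ LinearMap.range δ) (hcz : c • z = z) (hbz : b • z ∈ LinearMap.range δ)
    (hbc : ∀ a, b * a = 0 → c * a = 0) : HasDominantDimension A 2 := by
  refine ⟨nonempty_minimalInjectiveResolution A A, fun I => ?_⟩
  have hδi : ∀ a, δ (i a) = 0 := fun a => (hex _).2 ⟨a, rfl⟩
  have hdι : ∀ a, I.d 0 (I.ι a) = 0 := fun a => (I.exact_zero _).2 ⟨a, rfl⟩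
  have := I.injective_obj
  -- Comparison maps s₀, s₁ from the minimal resolution to M → M, and t₀, t₁ back. Minimality makes
  -- s₀ and s₁ injective, so I₀ and I₁ are summands of M.
  obtain ⟨s₀, hs₀⟩ := Module.Injective.out (R := A) I.ι I.injective_ι i
  obtain ⟨t₀, ht₀⟩ := Module.Injective.out (R := A) i hi I.ι
  have hs₀inj : Function.Injective s₀ := I.essential_ι.injective_of_comp fun a ha => by
    rw [hs₀] at ha
    rw [hi (ha.trans (map_zero i).symm), map_zero]
  obtain ⟨s₁, hs₁⟩ := Module.Injective.exists_comp_eq (I.d 0) (δ ∘ₗ s₀) fun x hx => by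
    obtain ⟨a, rfl⟩ := (I.exact_zero x).1 hx
    simp [hs₀, hδi]
  have hs₁inj : Function.Injective s₁ := (I.essential_d 0).injective_of_comp fun x hx => by
    rw [hs₁] at hx
    obtain ⟨a, ha⟩ := (hex _).1 hx
    rw [← hs₀] at ha
    rw [← hs₀inj ha, hdι]
  obtain ⟨t₁, ht₁⟩ := Module.Injective.exists_comp_eq δ (I.d 0 ∘ₗ t₀) fun x hx => by
    obtain ⟨a, rfl⟩ := (hex x).1 hx
    simp [ht₀, hdι]
  -- The homotopy h satisfies h ∘ δ = id - s₀ ∘ t₀; hence id - s₁ ∘ t₁ - δ ∘ h vanishes on the range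
  -- of δ.
  obtain ⟨h, hh⟩ := Module.Injective.exists_comp_eq δ (LinearMap.id - s₀ ∘ₗ t₀) fun x hx => by
    obtain ⟨a, rfl⟩ := (hex x).1 hx
    simp [ht₀, hs₀]
  have kill : ∀ {P : Type u} [AddCommGroup P] [Module A P] [Module.Projective A P]
      (φ : M →ₗ[A] P), (∀ m, φ (δ m) = 0) → φ z = 0 := by
    intro P _ _ _ φ hφ
    obtain ⟨m, hm⟩ := hbz
    rw [← hcz, map_smul]
    refine Module.Projective.smul_eq_zero_of hbc ?_
    rw [← map_smul, ← hm, hφ]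
  have h2 : ¬ Module.Projective A (I.obj 2) := by
    intro hproj
    -- If I₂ were projective, d₁ would kill t₁ z, so t₁ z would come from some x in I₀, and the
    -- homotopy would put z in the range of δ.
    have hq := kill (I.d 1 ∘ₗ t₁) fun m => by
      simpa [ht₁] using (I.exact_succ 0 _).2 ⟨t₀ m, rfl⟩
    obtain ⟨x, hx⟩ := (I.exact_succ 0 _).1 hq
    have hg := kill (LinearMap.id - s₁ ∘ₗ t₁ - δ ∘ₗ h) fun m => by simp [ht₁, hs₁, hh]
    refine hz ⟨s₀ x + h z, ?_⟩
    have e : s₁ (t₁ z) = δ (s₀ x) := by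
      rw [← hx]
      exact hs₁ x
    simp only [LinearMap.sub_apply, LinearMap.comp_apply, LinearMap.id_apply, e] at hg
    rw [map_add, eq_comm, ← sub_eq_zero, ← hg]
    abel
  rw [MinimalInjectiveResolution.firstNonprojective]
  refine le_antisymm ((iInf₂_le 2 h2).trans (by simp)) (le_iInf₂ fun n hn => ?_)
  match n with
  | 0 => exact absurd (Module.Injective.projective_of_injective s₀ hs₀inj) hn
  | 1 => exact absurd (Module.Injective.projective_of_injective s₁ hs₁inj) hn
  | n + 2 => exact_mod_cast Nat.le_add_left 2 n

end DominantDimension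

/-! ### Matrix algebras defined by an involution on the index set -/

section SwapAlgebra

variable {X : Type*} [DecidableEq X] {R : Type*} [Field R] {σ : X → X}

/-- The indicator function of `{y, σ y}`. -/
def orbitIndicator (R : Type*) [Field R] (σ : X → X) (y i : X) : R :=
  if i = y ∨ i = σ y then 1 else 0

theorem orbitIndicator_apply_self (σ : X → X) (y : X) : orbitIndicator R σ y y = 1 := by
  simp [orbitIndicator]

theorem orbitIndicator_apply_swap {σ : X → X} (hσ : Function.Involutive σ) (y i : X) :
    orbitIndicator R σ y (σ i) = orbitIndicator R σ y i := by
  refine if_congr ?_ rfl rfl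
  rw [hσ.injective.eq_iff, hσ.eq_iff, or_comm]

theorem card_orbit_ne_zero (h2 : (2 : R) ≠ 0 ∨ ∀ y, σ y = y) (y : X) :
    ((({y, σ y} : Finset X).card : ℕ) : R) ≠ 0 := by
  by_cases hy : σ y = y
  · simp [hy]
  · rw [Finset.card_pair (Ne.symm hy)]
    exact_mod_cast h2.resolve_right fun h => hy (h y)

theorem card_orbit_pair_ne_zero (h2 : (2 : R) ≠ 0 ∨ ∀ y, σ y = y) (y z : X) :
    ((({(y, z), (σ y, σ z)} : Finset (X × X)).card : ℕ) : R) ≠ 0 := by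
  by_cases hy : (y, z) = (σ y, σ z)
  · rw [← hy]
    simp
  · rw [Finset.card_pair hy]
    exact_mod_cast h2.resolve_right fun h => hy (by rw [h, h])

variable [Fintype X]

theorem sum_mul_orbitIndicator {σ : X → X} {y : X} (hy : σ y ≠ y) (f : X → R) :
    ∑ k, f k * orbitIndicator R σ y k = f y + f (σ y) := by
  have : ∀ k, f k * orbitIndicator R σ y k = if k ∈ ({y, σ y} : Finset X) then f k else 0 := by
    intro k
    simp [orbitIndicator]
  simp only [this, Finset.sum_ite_mem, Finset.univ_inter]
  exact Finset.sum_pair hy.symm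

/-- The matrix whose column `z` is the indicator of `{y, σ y}` and whose other columns vanish. -/
def orbitColumn (R : Type*) [Field R] (σ : X → X) (y z : X) : Matrix X X R :=
  Matrix.of fun i j => if j = z then orbitIndicator R σ y i else 0

theorem mul_orbitColumn_apply {σ : X → X} {y : X} (hy : σ y ≠ y) (z : X) (a : Matrix X X R)
    (i j : X) : (a * orbitColumn R σ y z) i j = if j = z then a i y + a i (σ y) else 0 := by
  rw [Matrix.mul_apply]
  by_cases h : j = z
  · simp [orbitColumn, h, sum_mul_orbitIndicator hy]
  · simp [orbitColumn, h]

theorem orbitColumn_mul_apply (σ : X → X) (y z : X) (a : Matrix X X R) (i j : X) :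
    (orbitColumn R σ y z * a) i j = orbitIndicator R σ y i * a z j := by
  simp [Matrix.mul_apply, orbitColumn]

theorem orbitColumn_mul_eq_zero {σ : X → X} {y z : X} {a : Matrix X X R}
    (h : orbitColumn R σ y z * a = 0) (j : X) : a z j = 0 := by
  have := congrFun (congrFun h y) j
  rwa [orbitColumn_mul_apply, orbitIndicator_apply_self, one_mul] at this

variable {A : Subalgebra R (Matrix X X R)}

/-- The Jacobson radical is nilpotent, so a radical element a has all products a * b nilpotent,
hence of trace zero. -/
theorem isSemisimpleRing_of_trace
    (h : ∀ a ∈ A, (∀ b ∈ A, (a * b).trace = 0) → a = 0) : IsSemisimpleRing A := by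
  have := IsArtinianRing.of_finite R A
  rw [IsArtinianRing.isSemisimpleRing_iff_jacobson, eq_bot_iff]
  intro a ha
  refine Subtype.ext (h a a.2 fun b hb => ?_)
  obtain ⟨n, hn⟩ := IsSemiprimaryRing.isNilpotent (R := A)
  have hab : a * ⟨b, hb⟩ ∈ Ring.jacobson A := Ideal.mul_mem_right _ _ ha
  have hpow : (a * ⟨b, hb⟩) ^ n = 0 := by
    have := Ideal.pow_mem_pow hab n
    rwa [hn] at this
  exact (Matrix.isNilpotent_trace_of_isNilpotent
    ⟨n, by simpa using congrArg Subtype.val hpow⟩).eq_zero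

/-- The trace of the product with a matrix which is the indicator of the transpose of a finset. -/
theorem trace_mul_of_indicator (a : Matrix X X R) (s : Finset (X × X)) :
    (a * Matrix.of fun w v => if (v, w) ∈ s then 1 else 0).trace = ∑ q ∈ s, a q.1 q.2 := by
  simp only [Matrix.trace, Matrix.diag, Matrix.mul_apply, Matrix.of_apply, mul_ite, mul_one,
    mul_zero]
  rw [← Fintype.sum_prod_type' (fun v w => if (v, w) ∈ s then a v w else 0)]
  simp

/-! ### Arbitrary classes: semisimplicity and dominant dimension 0 -/

section Classes

variable {Q : Type*} {κ : X → Q}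

/-- Elements of A are constant on orbits of entries. Pairing with the indicator of a transposed
orbit gives the entry times the orbit size, a power of 2 that is nonzero in R by hypothesis. -/
theorem isSemisimpleRing_of_swap (hσ : Function.Involutive σ) (hκ : ∀ y, κ (σ y) = κ y)
    (hA : ∀ a, a ∈ A ↔ (∀ y z, a (σ y) (σ z) = a y z) ∧
      ∀ y z, κ y ≠ κ z → a (σ y) z = a y z)
    (h2 : (2 : R) ≠ 0 ∨ ∀ y, σ y = y) : IsSemisimpleRing A := by
  refine isSemisimpleRing_of_trace fun a ha h => ?_
  obtain ⟨ha1, ha2⟩ := (hA a).1 ha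
  ext y z
  suffices H : ∃ s : Finset (X × X), (Matrix.of fun w v => if (v, w) ∈ s then (1 : R) else 0) ∈ A ∧
      (∀ q ∈ s, a q.1 q.2 = a y z) ∧ (s.card : R) ≠ 0 by
    obtain ⟨s, hs, hsa, hcard⟩ := H
    have := h _ hs
    rw [trace_mul_of_indicator, Finset.sum_congr rfl hsa, Finset.sum_const, nsmul_eq_mul] at this
    exact (mul_eq_zero.1 this).resolve_left hcard
  -- Within a class the orbit of (y, z) is {(y, z), (σ y, σ z)}; between classes it is the rectangle
  -- {y, σ y} × {z, σ z}.
  by_cases hyz : κ y = κ z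
  · refine ⟨{(y, z), (σ y, σ z)}, (hA _).2 ⟨fun w v => ?_, fun w v hwv => ?_⟩, ?_,
      card_orbit_pair_ne_zero h2 y z⟩
    · refine if_congr ?_ rfl rfl
      simp only [Finset.mem_insert, Finset.mem_singleton, Prod.mk.injEq, hσ.eq_iff, hσ y, hσ z]
      tauto
    · rw [Matrix.of_apply, Matrix.of_apply, if_neg, if_neg]
      · simp only [Finset.mem_insert, Finset.mem_singleton, Prod.mk.injEq]
        rintro (⟨rfl, rfl⟩ | ⟨rfl, rfl⟩)
        · exact hwv hyz.symm
        · exact hwv (by rw [hκ, hκ, hyz])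
      · simp only [Finset.mem_insert, Finset.mem_singleton, Prod.mk.injEq]
        rintro (⟨rfl, rfl⟩ | ⟨rfl, h⟩)
        · exact hwv (by rw [← hκ w, hyz])
        · rw [hσ.injective.eq_iff] at h
          exact hwv (by rw [hκ, h, hyz])
    · simp [ha1]
  · have ha3 : ∀ w v, κ w ≠ κ v → a w (σ v) = a w v := fun w v hwv => by
      rw [← ha2 w _ (by rwa [hκ]), ha1]
    refine ⟨{y, σ y} ×ˢ {z, σ z}, (hA _).2 ⟨fun w v => ?_, fun w v _ => ?_⟩, ?_, ?_⟩
    · refine if_congr ?_ rfl rfl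
      simp only [Finset.mem_product, Finset.mem_insert, Finset.mem_singleton, hσ.eq_iff, hσ y, hσ z]
      tauto
    · refine if_congr ?_ rfl rfl
      simp only [Finset.mem_product, Finset.mem_insert, Finset.mem_singleton, hσ.eq_iff, hσ z]
      tauto
    · rintro ⟨w, v⟩ hq
      simp only [Finset.mem_product, Finset.mem_insert, Finset.mem_singleton] at hq
      rcases hq with ⟨rfl | rfl, rfl | rfl⟩
      · rfl
      · exact ha3 _ _ hyz
      · exact ha2 _ _ hyz
      · exact ha1 _ _
    · rw [Finset.card_product, Nat.cast_mul]
      exact mul_ne_zero (card_orbit_ne_zero h2 y) (card_orbit_ne_zero h2 z)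

/-- Column z of a * `orbitColumn R σ y z` has entries a i y + a i (σ y), which are 2 * a i y = 0 for
i outside the class of y. So the left ideals of the orbit columns of y and w live on rows of
different classes, separated by a diagonal idempotent. Right multiplication of either column by a
sees only row z of a. -/
theorem hasDominantDimension_zero_of_swap (hσ : Function.Involutive σ) (hκ : ∀ y, κ (σ y) = κ y)
    (hA : ∀ a, a ∈ A ↔ (∀ y z, a (σ y) (σ z) = a y z) ∧
      ∀ y z, κ y ≠ κ z → a (σ y) z = a y z)
    (h2 : (2 : R) = 0) {y w z : X} (hy : σ y ≠ y) (hw : σ w ≠ w) (hz : σ z = z)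
    (hyw : κ y ≠ κ w) : HasDominantDimension A 0 := by
  classical
  have hadd : ∀ t : R, t + t = 0 := fun t => by rw [← two_mul, h2, zero_mul]
  have hright : ∀ a ∈ A, ∀ w v, κ w ≠ κ v → a w (σ v) = a w v := fun a ha w v hwv => by
    rw [← ((hA a).1 ha).2 w _ (by rwa [hκ]), ((hA a).1 ha).1]
  have hcol : ∀ y, orbitColumn R σ y z ∈ A := fun y => (hA _).2 ⟨fun i j => by
      have : σ j = z ↔ j = z := by rw [hσ.eq_iff, hz]
      simp [orbitColumn, orbitIndicator_apply_swap hσ, this],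
    fun i j _ => by simp [orbitColumn, orbitIndicator_apply_swap hσ]⟩
  have he : Matrix.diagonal (fun i => if κ i = κ y then (1 : R) else 0) ∈ A := (hA _).2
    ⟨fun i j => by simp [Matrix.diagonal_apply, hσ.injective.eq_iff, hκ], fun i j hij => by
      rw [Matrix.diagonal_apply_ne, Matrix.diagonal_apply_ne]
      · rintro rfl
        exact hij rfl
      · rintro rfl
        exact hij (hκ i).symm⟩
  refine HasDominantDimension.zero_of_mul (u := ⟨_, hcol y⟩) (v := ⟨_, hcol w⟩) (e := ⟨_, he⟩)
    (fun h => ?_) (fun a => Subtype.ext ?_) (fun a => Subtype.ext ?_) fun a h => Subtype.ext ?_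
  · have := congrFun (congrFun (congrArg Subtype.val h) y) z
    simp [orbitColumn, orbitIndicator_apply_self] at this
  · ext i j
    simp only [MulMemClass.coe_mul, Matrix.diagonal_mul, mul_orbitColumn_apply hy]
    by_cases hi : κ i = κ y
    · simp [hi]
    · simp [hi, hright a a.2 i y hi, hadd]
  · ext i j
    simp only [MulMemClass.coe_mul, Matrix.diagonal_mul, mul_orbitColumn_apply hw]
    by_cases hi : κ i = κ y
    · simp [hright a a.2 i w (by rwa [hi]), hadd]
    · simp [hi]
  · ext i j
    have := orbitColumn_mul_eq_zero (congrArg Subtype.val h) j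
    simp [orbitColumn_mul_apply, this]

end Classes

/-! ### One class: the centralizer of an involution -/

section SingleClass

/-- A matrix in A supported on columns y and σ y is determined by its column y, which is arbitrary
as σ y ≠ y. Hence the column module, and with it the matrix module, is a summand of a free module.
-/
theorem projective_matrix_of_swap (hσ : Function.Involutive σ)
    (hA : ∀ a, a ∈ A ↔ ∀ y z, a (σ y) (σ z) = a y z) {y : X} (hy : σ y ≠ y) :
    Module.Projective A (Matrix X X R) := by
  -- Column w of m is placed in column y, and its σ-translate in column σ y.
  let col : X → Matrix X X R → Matrix X X R := fun w m =>
    Matrix.of fun u v => if v = y then m u w else if v = σ y then m (σ u) w else 0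
  have hcol : ∀ w m, col w m ∈ A := fun w m => (hA _).2 fun u v => by
    by_cases h1 : v = y
    · subst h1
      simp [col, hy, hσ u]
    · by_cases h3 : v = σ y
      · subst h3
        simp [col, hy, hσ y]
      · have h4 : σ v ≠ y := fun h => h3 (by rw [← h, hσ])
        simp [col, h1, h3, h4, hσ.injective.eq_iff]
  let i : Matrix X X R →ₗ[A] (X → A) :=
    { toFun := fun m w => ⟨col w m, hcol w m⟩
      map_add' := fun m n => by
        ext w u v
        simp only [col, Pi.add_apply, AddMemClass.coe_add, Matrix.add_apply, Matrix.of_apply]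
        split_ifs <;> simp
      map_smul' := fun a m => by
        ext w u v
        have ha := (hA a).1 a.2
        simp only [col, RingHom.id_apply, Pi.smul_apply, smul_eq_mul, MulMemClass.coe_mul,
          Subalgebra.smul_def, Matrix.mul_apply, Matrix.of_apply]
        split_ifs
        · rfl
        · rw [← Equiv.sum_comp hσ.toPerm]
          simp [ha]
        · simp }
  let r : (X → A) →ₗ[A] Matrix X X R :=
    { toFun := fun f => Matrix.of fun u w => (f w : Matrix X X R) u y
      map_add' := fun f g => by
        ext
        simp
      map_smul' := fun a f => by
        ext
        simp [Subalgebra.smul_def, Matrix.mul_apply] }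
  refine Module.Projective.of_split i r ?_
  ext m u w
  simp [i, r, col]

/-- The column module is dual to the right ideal with basis b u = E_{y,u} + E_{σy,σu}. A
homomorphism g is recovered from row y of its values, since row u of g n is row y of g (b u * n);
extending it is therefore a problem of linear algebra over R. -/
theorem injective_matrix_of_swap (hσ : Function.Involutive σ)
    (hA : ∀ a, a ∈ A ↔ ∀ y z, a (σ y) (σ z) = a y z) {y : X} (hy : σ y ≠ y) :
    Module.Injective A (Matrix X X R) := by
  let b : X → Matrix X X R := fun u =>
    Matrix.of fun i j => if i = y then (if j = u then 1 else 0)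
      else if i = σ y then (if j = σ u then 1 else 0) else 0
  have hb : ∀ u, b u ∈ A := fun u => (hA _).2 fun i j => by
    by_cases h1 : i = y
    · subst h1
      simp [b, hy, hσ.injective.eq_iff]
    · by_cases h3 : i = σ y
      · subst h3
        simp [b, hy, hσ y, hσ.eq_iff]
      · have h4 : σ i ≠ y := fun h => h3 (by rw [← h, hσ])
        simp [b, h1, h3, h4, hσ.injective.eq_iff]
  have hbmul : ∀ u (m : Matrix X X R) w, (b u * m) y w = m u w := fun u m w => by
    simp [b, Matrix.mul_apply]
  have hba : ∀ (a : A) u, (⟨b u, hb u⟩ : A) * a = ∑ v, a.1 u v • (⟨b v, hb v⟩ : A) := by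
    intro a u
    ext i j
    have ha := (hA a).1 a.2
    have e : ∀ v : X, (j = σ v) = (v = σ j) := fun v =>
      propext (by rw [@eq_comm _ j, hσ.eq_iff])
    have e' := ha u (σ j)
    rw [hσ] at e'
    simp only [MulMemClass.coe_mul, AddSubmonoidClass.coe_finsetSum, SetLike.val_smul,
      Matrix.sum_apply, Matrix.smul_apply, Matrix.mul_apply, b, Matrix.of_apply, smul_eq_mul]
    split_ifs
    · simp
    · simp [e, e']
    · simp
  refine Module.Baer.injective fun I g => ?_
  -- Row y of g is only R-linear on the ideal. It extends linearly to A, and placing ψ' (b u * n) in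
  -- row u restores A-linearity.
  let ψ : I.restrictScalars R →ₗ[R] (X → R) :=
    { toFun := fun n => g n y
      map_add' := fun m n => by
        rw [show g (m + n) = g m + g n from map_add g m n]
        rfl
      map_smul' := fun c n => by
        have e : c • n = (algebraMap R A c • (show I from n) : I) :=
          Subtype.ext (algebraMap_smul A c n.1).symm
        have : g (c • n) = c • g n := by
          rw [e, map_smul, algebraMap_smul]
        rw [RingHom.id_apply, this]
        rfl }
  obtain ⟨ψ', hψ'⟩ := LinearMap.exists_extend ψ
  refine ⟨{ toFun := fun n => Matrix.of fun u => ψ' (⟨b u, hb u⟩ * n)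
            map_add' := fun m n => by
              ext u w
              simp [mul_add]
            map_smul' := fun a n => by
              ext u w
              have e : (⟨b u, hb u⟩ : A) * (a * n) = ∑ v, a.1 u v • (⟨b v, hb v⟩ * n) := by
                rw [← mul_assoc, hba, Finset.sum_mul]
                simp only [smul_mul_assoc]
              simp only [Matrix.of_apply, smul_eq_mul, e, map_sum, LinearMap.map_smul]
              simp [Subalgebra.smul_def, Matrix.mul_apply] }, fun n hn => ?_⟩
  ext u w
  have hmem : (⟨b u, hb u⟩ : A) * n ∈ I := I.mul_mem_left _ hn
  have e : ψ' (⟨b u, hb u⟩ * n) = g ⟨_, hmem⟩ y := DFunLike.congr_fun hψ' ⟨_, hmem⟩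
  have e' : g ⟨_, hmem⟩ = (⟨b u, hb u⟩ : A) • g ⟨n, hn⟩ := map_smul g _ (⟨n, hn⟩ : I)
  change ψ' (⟨b u, hb u⟩ * n) w = _
  rw [e, e']
  exact hbmul u _ w

theorem hasDominantDimension_two_of_swap (hσ : Function.Involutive σ)
    (hA : ∀ a, a ∈ A ↔ ∀ y z, a (σ y) (σ z) = a y z) (h2 : (2 : R) = 0) {y z : X}
    (hy : σ y ≠ y) (hz : σ z = z) : HasDominantDimension A 2 := by
  have := projective_matrix_of_swap hσ hA hy
  have := injective_matrix_of_swap hσ hA hy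
  have hadd : ∀ t : R, t + t = 0 := fun t => by rw [← two_mul, h2, zero_mul]
  let i : A →ₗ[A] Matrix X X R :=
    { toFun := Subtype.val
      map_add' := fun _ _ => rfl
      map_smul' := fun _ _ => rfl }
  let δ : Matrix X X R →ₗ[A] Matrix X X R :=
    { toFun := fun m => Matrix.of fun u v => m u v + m (σ u) (σ v)
      map_add' := fun m n => by
        ext
        simp only [Matrix.of_apply, Matrix.add_apply]
        ring
      map_smul' := fun a m => by
        ext u v
        have ha := (hA a).1 a.2
        simp only [RingHom.id_apply, Subalgebra.smul_def, smul_eq_mul, Matrix.mul_apply,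
          Matrix.of_apply, mul_add, Finset.sum_add_distrib]
        congr 1
        rw [← Equiv.sum_comp hσ.toPerm]
        simp [ha] }
  have hb : orbitColumn R σ y z ∈ A := (hA _).2 fun i j => by
    have : σ j = z ↔ j = z := by rw [hσ.eq_iff, hz]
    simp [orbitColumn, orbitIndicator_apply_swap hσ, this]
  have hc : Matrix.single z z (1 : R) ∈ A := (hA _).2 fun i j => by
    have : ∀ j, z = σ j ↔ z = j := fun j => by rw [eq_comm, hσ.eq_iff, hz, eq_comm]
    simp [Matrix.single_apply, this]
  -- The cokernel element is the class of E_zz. Since σ z = z, each δ m has (z, z) entry 2 * m z z =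
  -- 0, so the class is nonzero. Multiplying E_zz by the orbit column b gives b = E_{y,z} + E_{σy,z}
  -- = δ E_{y,z}, while b * a = 0 forces row z of a to vanish.
  refine HasDominantDimension.two_of_exact i δ Subtype.val_injective (fun m => ?_)
    (b := ⟨_, hb⟩) (c := ⟨_, hc⟩) (z := Matrix.single z z 1) ?_ ?_ ?_ fun a h => Subtype.ext ?_
  · constructor
    · intro h
      refine ⟨⟨m, (hA m).2 fun u v => ?_⟩, rfl⟩
      have := congrFun (congrFun h u) v
      change m u v + m (σ u) (σ v) = 0 at this
      rw [← add_right_inj (m u v), this, hadd]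
    · rintro ⟨a, rfl⟩
      ext u v
      change a.1 u v + a.1 (σ u) (σ v) = 0
      rw [(hA a).1 a.2, hadd]
  · rintro ⟨m, hm⟩
    have := congrFun (congrFun hm z) z
    change m z z + m (σ z) (σ z) = _ at this
    rw [hz, hadd] at this
    simp at this
  · simp [Subalgebra.smul_def]
  · refine ⟨Matrix.single y z 1, ?_⟩
    ext u v
    change Matrix.single y z (1 : R) u v + Matrix.single y z (1 : R) (σ u) (σ v) =
      (orbitColumn R σ y z * Matrix.single z z (1 : R) : Matrix X X R) u v
    rw [orbitColumn_mul_apply]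
    have h1 : z = σ v ↔ z = v := by rw [eq_comm, hσ.eq_iff, hz, eq_comm]
    have h3 : y = σ u ↔ u = σ y := by rw [eq_comm, hσ.eq_iff]
    by_cases hu : u = y
    · subst hu
      simp [Matrix.single_apply, orbitIndicator, hy.symm]
    · by_cases hv : z = v
      · subst hv
        simp [Matrix.single_apply, orbitIndicator, hz, h3, hu, Ne.symm hu]
      · simp [h1, hv]
  · ext u v
    have := orbitColumn_mul_eq_zero (congrArg Subtype.val h) v
    by_cases hu : u = z
    · subst hu
      simp [this]
    · simp [hu]

end SingleClass

end SwapAlgebra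

/-! ### The Terwilliger algebra of a quasi-thin scheme -/

namespace AssociationScheme

variable {X : Type*} [Fintype X] {d : ℕ} (S : AssociationScheme X d)

/-- The index of the relation which contains `(x, y)`. -/
noncomputable def relIndex (x y : X) : Fin (d + 1) :=
  (S.existsUnique_rel x y).choose

theorem rel_relIndex (x y : X) : S.rel (S.relIndex x y) x y :=
  (S.existsUnique_rel x y).choose_spec.1

variable {S} in
theorem relIndex_eq_iff {x y : X} {i : Fin (d + 1)} : S.relIndex x y = i ↔ S.rel i x y :=
  ⟨fun h => h ▸ S.rel_relIndex x y, fun h => S.rel_unique (S.rel_relIndex x y) h⟩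

theorem exists_rel_of_valency_ne_zero {i : Fin (d + 1)} (hi : S.valency i ≠ 0) (x : X) :
    ∃ y, S.rel i x y := by
  rw [S.valency_eq i x] at hi
  exact Set.nonempty_of_ncard_ne_zero hi

theorem valency_ne_zero (i : Fin (d + 1)) : S.valency i ≠ 0 := by
  obtain ⟨x, y, h⟩ := S.rel_nonempty i
  rw [S.valency_eq i x]
  exact ((Set.ncard_pos (Set.toFinite _)).2 ⟨y, h⟩).ne'

theorem exists_other_of_valency {x y : X} (h : S.valency (S.relIndex x y) = 2) :
    ∃ z, z ≠ y ∧ S.relIndex x z = S.relIndex x y := by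
  rw [S.valency_eq _ x] at h
  obtain ⟨z, hz, hzy⟩ := Set.exists_ne_of_one_lt_ncard (s := {z | S.rel (S.relIndex x y) x z})
    (by omega) y
  exact ⟨z, hzy, relIndex_eq_iff.2 hz⟩

open Classical in
/-- The involution on `X` interchanging the two points of each set `xRᵢ` with `kᵢ = 2`. -/
noncomputable def swap (x y : X) : X :=
  if h : S.valency (S.relIndex x y) = 2 then (S.exists_other_of_valency h).choose else y

@[simp]
theorem relIndex_swap (x y : X) : S.relIndex x (S.swap x y) = S.relIndex x y := by
  rw [swap]
  split_ifs with h
  · exact (S.exists_other_of_valency h).choose_spec.2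
  · rfl

theorem swap_ne_iff {x y : X} : S.swap x y ≠ y ↔ S.valency (S.relIndex x y) = 2 := by
  rw [swap]
  split_ifs with h
  · simp [h, (S.exists_other_of_valency h).choose_spec.1]
  · simp [h]

variable {S}

theorem IsQuasiThin.eq_or_eq_swap (hS : S.IsQuasiThin) {x y z : X}
    (h : S.relIndex x z = S.relIndex x y) : z = y ∨ z = S.swap x y := by
  classical
  by_contra! hne
  have hcard := hS (S.relIndex x y)
  rw [S.valency_eq _ x] at hcard
  have hz : S.rel (S.relIndex x y) x z := relIndex_eq_iff.1 h
  by_cases hy : S.swap x y = y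
  · have hv : S.valency (S.relIndex x y) ≠ 2 := fun hv => S.swap_ne_iff.2 hv hy
    rw [S.valency_eq _ x] at hv
    refine hne.1 ((Set.ncard_le_one (Set.toFinite _)).1
      (by omega : {z | S.rel (S.relIndex x y) x z}.ncard ≤ 1) z hz y (S.rel_relIndex x y))
  · have hsub : (({y, S.swap x y, z} : Finset X) : Set X) ⊆ {z | S.rel (S.relIndex x y) x z} := by
      intro w hw
      simp only [Finset.coe_insert, Finset.coe_singleton, Set.mem_insert_iff,
        Set.mem_singleton_iff] at hw
      rcases hw with rfl | rfl | rfl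
      · exact S.rel_relIndex x w
      · exact relIndex_eq_iff.1 (S.relIndex_swap x y)
      · exact hz
    have h3 := Set.ncard_le_ncard hsub (Set.toFinite _)
    rw [Set.ncard_coe_finset, Finset.card_eq_three.2
      ⟨y, S.swap x y, z, Ne.symm hy, hne.1.symm, hne.2.symm, rfl⟩] at h3
    omega

theorem IsQuasiThin.swap_involutive (hS : S.IsQuasiThin) (x : X) :
    Function.Involutive (S.swap x) := by
  intro y
  by_cases hy : S.swap x y = y
  · rw [hy, hy]
  · have h := S.swap_ne_iff.1 hy
    rw [← S.relIndex_swap x y, ← S.swap_ne_iff] at h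
    exact (hS.eq_or_eq_swap (by simp)).resolve_right h

/-- Regularity of the scheme: the number of points of xR_i, or of xR_j, in relation l to a given
point is the same for both points of the other set. -/
theorem rel_swap_swap (hS : S.IsQuasiThin) {x y z : X} {l : Fin (d + 1)} (h : S.rel l y z) :
    S.rel l (S.swap x y) (S.swap x z) := by
  have hy := relIndex_eq_iff.1 (S.relIndex_swap x y)
  have hz := relIndex_eq_iff.1 (S.relIndex_swap x z)
  have hrow : 0 < S.intersectionNumber (S.relIndex x z) (S.transpose l) (S.relIndex x y) :=
    (S.intersectionNumber_pos _ _ _).2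
      ⟨x, y, z, S.rel_relIndex x y, S.rel_relIndex x z, (S.rel_transpose l z y).2 h⟩
  rw [S.intersectionNumber_eq _ _ hy, Set.ncard_pos] at hrow
  obtain ⟨w, hxw, hw⟩ := hrow
  rw [S.rel_transpose] at hw
  rcases hS.eq_or_eq_swap (relIndex_eq_iff.2 hxw) with rfl | rfl
  swap
  · exact hw
  -- Here both y and σ y are in relation l to z. Counting then shows that all points of the set of y
  -- are in relation l to σ z as well.
  have hall : {u | S.rel (S.relIndex x y) x u} ⊆ {u | S.rel (S.relIndex x y) x u ∧ S.rel l u w} := by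
    intro u hu
    rcases hS.eq_or_eq_swap (relIndex_eq_iff.2 hu) with rfl | rfl
    · exact ⟨hu, h⟩
    · exact ⟨hu, hw⟩
  have hcard := Set.ncard_le_ncard hall (Set.toFinite _)
  rw [← S.intersectionNumber_eq _ _ hxw, S.intersectionNumber_eq _ _ hz] at hcard
  have := Set.eq_of_subset_of_ncard_le (fun u hu => hu.1) hcard (Set.toFinite _)
  have hmem : S.swap x y ∈ {u | S.rel (S.relIndex x y) x u} := hy
  rw [← this] at hmem
  exact hmem.2

open Classical in
variable (S) in
/-- The equivalence class of the relation containing `(x, y)`, if it has valency `2`. -/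
noncomputable def classOf (x y : X) : Option (Quotient S.setoid₂) :=
  if h : S.valency (S.relIndex x y) = 2 then some (Quotient.mk _ ⟨S.relIndex x y, h⟩) else none

theorem classOf_congr {x y z : X} (h : S.relIndex x y = S.relIndex x z) :
    S.classOf x y = S.classOf x z := by
  simp only [classOf, h]

@[simp]
theorem classOf_swap (x y : X) : S.classOf x (S.swap x y) = S.classOf x y :=
  classOf_congr (by simp)

theorem classOf_eq_none_iff {x y : X} : S.classOf x y = none ↔ S.swap x y = y := by
  rw [← not_iff_not, ← ne_eq (S.swap x y), S.swap_ne_iff, classOf]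
  split_ifs with h <;> simp [h]

theorem classOf_eq_some {x y : X} (i : S.A₂) (h : S.rel i x y) :
    S.classOf x y = some (Quotient.mk _ i) := by
  obtain ⟨i, hi⟩ := i
  obtain rfl : S.relIndex x y = i := relIndex_eq_iff.2 h
  rw [classOf, dif_pos hi]

/-- Indices i, j in different classes have |R_{i'} R_j| = 1, so all pairs in xR_i × xR_j lie in one
relation. -/
theorem rel_swap_left (hS : S.IsQuasiThin) {x y z : X} {l : Fin (d + 1)}
    (hyz : S.classOf x y ≠ S.classOf x z) (h : S.rel l y z) : S.rel l (S.swap x y) z := by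
  by_cases hy : S.swap x y = y
  · rwa [hy]
  have hvy := S.swap_ne_iff.1 hy
  by_cases hz : S.swap x z = z
  · rw [← hz]
    exact rel_swap_swap hS h
  have hvz := S.swap_ne_iff.1 hz
  have hne : (S.relProduct (S.transpose (S.relIndex x y)) (S.relIndex x z)).ncard ≠ 2 := fun h2 =>
    hyz (by
      rw [classOf, classOf, dif_pos hvy, dif_pos hvz]
      exact congrArg some (Quotient.sound (Or.inl h2)))
  have h1 := ((S.ncard_relProduct_spec hvy (S.relIndex x z)).1.resolve_right hne).le
  have hmem : ∀ {u l}, S.relIndex x u = S.relIndex x y → S.rel l u z →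
      l ∈ S.relProduct (S.transpose (S.relIndex x y)) (S.relIndex x z) := fun {u l} hu hl =>
    (S.intersectionNumber_pos _ _ _).2
      ⟨u, z, x, hl, (S.rel_transpose _ _ _).2 (relIndex_eq_iff.1 hu), S.rel_relIndex x z⟩
  rw [(Set.ncard_le_one (Set.toFinite _)).1 h1 l (hmem rfl h) _
    (hmem (S.relIndex_swap x y) (S.rel_relIndex _ z))]
  exact S.rel_relIndex _ z

open Classical in
variable (S) in
/-- The involution interchanging the two points of each set `xRᵢ` with `i` in the class `c`. -/
noncomputable def classSwap (x : X) (c : Option (Quotient S.setoid₂)) (y : X) : X :=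
  if S.classOf x y = c then S.swap x y else y

theorem IsQuasiThin.classSwap_involutive (hS : S.IsQuasiThin) (x : X)
    (c : Option (Quotient S.setoid₂)) : Function.Involutive (S.classSwap x c) := by
  intro y
  by_cases h : S.classOf x y = c
  · simp [classSwap, h, hS.swap_involutive x y]
  · simp [classSwap, h]

theorem relIndex_classSwap (x : X) (c : Option (Quotient S.setoid₂)) (y : X) :
    S.relIndex x (S.classSwap x c y) = S.relIndex x y := by
  rw [classSwap]
  split_ifs <;> simp

theorem rel_classSwap_of_rel (hS : S.IsQuasiThin) {x y z : X} {l : Fin (d + 1)}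
    (c : Option (Quotient S.setoid₂)) (h : S.rel l y z) :
    S.rel l (S.classSwap x c y) (S.classSwap x c z) := by
  rw [classSwap, classSwap]
  split_ifs with hy hz hz
  · exact rel_swap_swap hS h
  · exact rel_swap_left hS (fun e => hz (e ▸ hy)) h
  · rw [← S.rel_transpose]
    exact rel_swap_left hS (fun e => hy (e ▸ hz)) ((S.rel_transpose l z y).2 h)
  · exact h

theorem rel_classSwap_iff (hS : S.IsQuasiThin) {x y z : X} {l : Fin (d + 1)}
    (c : Option (Quotient S.setoid₂)) :
    S.rel l (S.classSwap x c y) (S.classSwap x c z) ↔ S.rel l y z := by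
  refine ⟨fun h => ?_, rel_classSwap_of_rel hS c⟩
  have := rel_classSwap_of_rel (x := x) hS c h
  rwa [hS.classSwap_involutive x c y, hS.classSwap_involutive x c z] at this

/-! ### Description of the Terwilliger algebra by its entries -/

section Terwilliger

variable [DecidableEq X] {R : Type*} [Field R]

theorem adjMatrix_mem (x : X) (i : Fin (d + 1)) : S.adjMatrix R i ∈ S.terwilligerAlgebra R x :=
  Algebra.subset_adjoin (Or.inl ⟨i, rfl⟩)

theorem dualIdempotent_mem (x : X) (i : Fin (d + 1)) :
    S.dualIdempotent R x i ∈ S.terwilligerAlgebra R x :=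
  Algebra.subset_adjoin (Or.inr ⟨i, rfl⟩)

open Classical in
theorem dualIdempotent_eq_diagonal (x : X) (i : Fin (d + 1)) :
    S.dualIdempotent R x i = Matrix.diagonal fun y => if S.rel i x y then 1 else 0 := by
  rw [← Matrix.sum_single_eq_diagonal, dualIdempotent, Finset.sum_filter]
  refine Finset.sum_congr rfl fun y _ => ?_
  split_ifs <;> simp

open Classical in
theorem dualIdempotent_mul_mul_apply (x : X) (i j : Fin (d + 1)) (a : Matrix X X R) (y z : X) :
    (S.dualIdempotent R x i * a * S.dualIdempotent R x j) y z =
      if S.rel i x y ∧ S.rel j x z then a y z else 0 := by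
  rw [dualIdempotent_eq_diagonal, dualIdempotent_eq_diagonal, Matrix.mul_diagonal,
    Matrix.diagonal_mul]
  split_ifs <;> simp_all

/-- Swapping the points of one class only is an automorphism of every R_i that fixes each set xR_i,
so its permutation matrix commutes with all generators. -/
theorem apply_classSwap_of_mem (hS : S.IsQuasiThin) {x : X} {a : Matrix X X R}
    (ha : a ∈ S.terwilligerAlgebra R x) (c : Option (Quotient S.setoid₂)) (y z : X) :
    a (S.classSwap x c y) (S.classSwap x c z) = a y z := by
  classical
  have hinv := hS.classSwap_involutive x c
  induction ha using Algebra.adjoin_induction generalizing y z with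
  | mem a ha =>
    rcases ha with ⟨i, rfl⟩ | ⟨i, rfl⟩
    · simp [adjMatrix, rel_classSwap_iff hS]
    · have : S.rel i x (S.classSwap x c y) ↔ S.rel i x y := by
        rw [← relIndex_eq_iff, relIndex_classSwap, relIndex_eq_iff]
      simp [dualIdempotent_eq_diagonal, Matrix.diagonal_apply, hinv.injective.eq_iff, this]
  | algebraMap r => simp [Matrix.algebraMap_matrix_apply, hinv.injective.eq_iff]
  | add a b _ _ iha ihb => simp [iha, ihb]
  | mul a b _ _ iha ihb =>
    rw [Matrix.mul_apply, Matrix.mul_apply, ← Equiv.sum_comp hinv.toPerm]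
    simp [iha, ihb]

/-- When |R_{i'} R_j| = 2, the (i, j) block of the adjacency matrix of the relation through (y, z)
is a 2 × 2 permutation matrix: if (σ y, z) were in that relation too, only one relation would occur
in the block. -/
theorem single_add_single_mem_of_ncard_eq_two (hS : S.IsQuasiThin) (x : X) {i j : S.A₂}
    (hj : (S.relProduct (S.transpose i) j).ncard = 2) {y z : X} (hy : S.rel i x y)
    (hz : S.rel j x z) :
    Matrix.single y z (1 : R) + Matrix.single (S.swap x y) (S.swap x z) 1 ∈
      S.terwilligerAlgebra R x := by
  classical
  have hl := S.rel_relIndex y z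
  set l := S.relIndex y z with hldef
  have hy' : S.rel i x (S.swap x y) := by
    rw [← relIndex_eq_iff, relIndex_swap, relIndex_eq_iff]
    exact hy
  have hz' : S.rel j x (S.swap x z) := by
    rw [← relIndex_eq_iff, relIndex_swap, relIndex_eq_iff]
    exact hz
  have hcases : ∀ {i : Fin (d + 1)} {y u}, S.rel i x y → S.rel i x u →
      u = y ∨ u = S.swap x y := fun hy hu =>
    hS.eq_or_eq_swap ((relIndex_eq_iff.2 hu).trans (relIndex_eq_iff.2 hy).symm)
  have hyne : S.swap x y ≠ y := S.swap_ne_iff.2 (by rw [relIndex_eq_iff.2 hy, i.2])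
  have hzne : S.swap x z ≠ z := S.swap_ne_iff.2 (by rw [relIndex_eq_iff.2 hz, j.2])
  have hnot : ¬ S.rel l (S.swap x y) z := by
    intro h
    have : S.relProduct (S.transpose i) j ⊆ {l} := by
      intro l' hl'
      rw [mem_relProduct_transpose, S.intersectionNumber_eq _ _ hz, Set.ncard_pos] at hl'
      obtain ⟨u, hu, hul⟩ := hl'
      rcases hcases hy hu with rfl | rfl
      · exact S.rel_unique hul hl
      · exact S.rel_unique hul h
    have := Set.ncard_le_ncard this
    rw [hj, Set.ncard_singleton] at this
    omega
  have hnot' : ¬ S.rel l y (S.swap x z) := by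
    intro h
    have := rel_swap_swap (x := x) hS h
    rw [hS.swap_involutive x z] at this
    exact hnot this
  have hl' := rel_swap_swap (x := x) hS hl
  have key : S.dualIdempotent R x i * S.adjMatrix R l * S.dualIdempotent R x j =
      Matrix.single y z (1 : R) + Matrix.single (S.swap x y) (S.swap x z) 1 := by
    ext u v
    rw [dualIdempotent_mul_mul_apply, adjMatrix, Matrix.of_apply, Matrix.add_apply]
    by_cases huv : S.rel i x u ∧ S.rel j x v
    · rw [if_pos huv]
      rcases hcases hy huv.1 with rfl | rfl <;> rcases hcases hz huv.2 with rfl | rfl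
      · simp [hl, hyne]
      · simp [hnot', hyne, hzne.symm]
      · simp [hnot, hyne.symm, hzne]
      · simp [hl', hyne.symm]
    · rw [if_neg huv, Matrix.single_apply_of_ne, Matrix.single_apply_of_ne, add_zero]
      · rintro ⟨rfl, rfl⟩
        exact huv ⟨hy', hz'⟩
      · rintro ⟨rfl, rfl⟩
        exact huv ⟨hy, hz⟩
  rw [← key]
  exact mul_mem (mul_mem (dualIdempotent_mem x i.1) (adjMatrix_mem x l))
    (dualIdempotent_mem x j.1)

/-- Permutation blocks multiply along a chain of pairs with |R_{i'} R_j| = 2; the cross terms vanish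
because w ≠ σ w. This is how bad pairs are reached. -/
theorem single_add_single_mem (hS : S.IsQuasiThin) (x : X) {i j : S.A₂}
    (hij : S.Equiv₂ i j) {y z : X} (hy : S.rel i x y) (hz : S.rel j x z) :
    Matrix.single y z (1 : R) + Matrix.single (S.swap x y) (S.swap x z) 1 ∈
      S.terwilligerAlgebra R x := by
  rw [equiv₂_iff_transGen] at hij
  induction hij generalizing z with
  | single hj => exact single_add_single_mem_of_ncard_eq_two hS x hj hy hz
  | @tail b j _ hbj ih =>
    obtain ⟨w, hw⟩ := S.exists_rel_of_valency_ne_zero (by rw [b.2]; decide) x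
    have hwne : S.swap x w ≠ w := S.swap_ne_iff.2 (by rw [relIndex_eq_iff.2 hw, b.2])
    have hmul := mul_mem (ih hw) (single_add_single_mem_of_ncard_eq_two hS x hbj hw hz)
    simpa [add_mul, mul_add, hwne, hwne.symm] using hmul

/-- Invariance under the class swaps gives one inclusion. For the other, a is cut into blocks by the
dual idempotents: a block within a class is a combination of the two permutation blocks, and any
other block is constant, hence a multiple of a block of the all-ones matrix. -/
theorem mem_terwilligerAlgebra_iff (hS : S.IsQuasiThin) (x : X) (a : Matrix X X R) :
    a ∈ S.terwilligerAlgebra R x ↔ (∀ y z, a (S.swap x y) (S.swap x z) = a y z) ∧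
      ∀ y z, S.classOf x y ≠ S.classOf x z → a (S.swap x y) z = a y z := by
  classical
  constructor
  · intro ha
    have hleft : ∀ y z, S.classOf x y ≠ S.classOf x z → a (S.swap x y) z = a y z := by
      intro y z hyz
      simpa [classSwap, hyz.symm] using apply_classSwap_of_mem hS ha (S.classOf x y) y z
    have hright : ∀ y z, S.classOf x y ≠ S.classOf x z → a y (S.swap x z) = a y z := by
      intro y z hyz
      simpa [classSwap, hyz] using apply_classSwap_of_mem hS ha (S.classOf x z) y z
    refine ⟨fun y z => ?_, hleft⟩
    by_cases hyz : S.classOf x y = S.classOf x z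
    · simpa [classSwap, hyz] using apply_classSwap_of_mem hS ha (S.classOf x z) y z
    · rw [hleft _ _ (by simpa using hyz), hright _ _ hyz]
  · rintro ⟨h1, h2⟩
    have hsum : ∑ i, S.dualIdempotent R x i = 1 := by
      ext y z
      simp only [Matrix.sum_apply, dualIdempotent_eq_diagonal, Matrix.diagonal_apply,
        Matrix.one_apply, ← relIndex_eq_iff]
      split_ifs <;> simp
    have ha : a = ∑ i, ∑ j, S.dualIdempotent R x i * a * S.dualIdempotent R x j := by
      simp only [← Finset.mul_sum, ← Finset.sum_mul, hsum, one_mul, mul_one]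
    rw [ha]
    refine sum_mem fun i _ => sum_mem fun j _ => ?_
    obtain ⟨y, hy⟩ := S.exists_rel_of_valency_ne_zero (S.valency_ne_zero i) x
    obtain ⟨z, hz⟩ := S.exists_rel_of_valency_ne_zero (S.valency_ne_zero j) x
    have hcases : ∀ {i : Fin (d + 1)} {y u}, S.rel i x y → S.rel i x u →
        u = y ∨ u = S.swap x y := fun hy hu =>
      hS.eq_or_eq_swap ((relIndex_eq_iff.2 hu).trans (relIndex_eq_iff.2 hy).symm)
    have hy' : S.rel i x (S.swap x y) := by
      rw [← relIndex_eq_iff, relIndex_swap, relIndex_eq_iff]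
      exact hy
    have hz' : S.rel j x (S.swap x z) := by
      rw [← relIndex_eq_iff, relIndex_swap, relIndex_eq_iff]
      exact hz
    by_cases hyz : S.classOf x y = S.classOf x z ∧ S.classOf x y ≠ none
    · obtain ⟨hyz, hne⟩ := hyz
      have hyne : S.swap x y ≠ y := fun h => hne (classOf_eq_none_iff.2 h)
      have hzne : S.swap x z ≠ z := fun h => hne (hyz.trans (classOf_eq_none_iff.2 h))
      have hi := S.swap_ne_iff.1 hyne
      have hj := S.swap_ne_iff.1 hzne
      rw [relIndex_eq_iff.2 hy] at hi
      rw [relIndex_eq_iff.2 hz] at hj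
      have hij : S.Equiv₂ ⟨i, hi⟩ ⟨j, hj⟩ := by
        rw [classOf_eq_some ⟨i, hi⟩ hy, classOf_eq_some ⟨j, hj⟩ hz] at hyz
        exact Quotient.exact (Option.some.inj hyz)
      have key : S.dualIdempotent R x i * a * S.dualIdempotent R x j =
          a y z • (Matrix.single y z (1 : R) + Matrix.single (S.swap x y) (S.swap x z) 1) +
          a y (S.swap x z) • (Matrix.single y (S.swap x z) (1 : R) +
            Matrix.single (S.swap x y) (S.swap x (S.swap x z)) 1) := by
        have e := h1 y (S.swap x z)
        rw [hS.swap_involutive x z] at e ⊢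
        ext u v
        rw [dualIdempotent_mul_mul_apply]
        by_cases huv : S.rel i x u ∧ S.rel j x v
        · rw [if_pos huv]
          rcases hcases hy huv.1 with rfl | rfl <;> rcases hcases hz huv.2 with rfl | rfl
          · simp [hyne, hzne]
          · simp [hyne, hzne.symm]
          · simp [hyne.symm, hzne, e]
          · simp [hyne.symm, hzne.symm, h1]
        · rw [if_neg huv]
          have hn : ∀ y' z' (c : R), S.rel i x y' → S.rel j x z' → Matrix.single y' z' c u v = 0 := by
            intro y' z' c hy' hz'
            rw [Matrix.single_apply_of_ne]
            rintro ⟨rfl, rfl⟩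
            exact huv ⟨hy', hz'⟩
          simp [hn _ _ _ hy hz, hn _ _ _ hy' hz', hn _ _ _ hy hz', hn _ _ _ hy' hz]
      rw [key]
      exact add_mem (Subalgebra.smul_mem _ (single_add_single_mem hS x hij hy hz) _)
        (Subalgebra.smul_mem _ (single_add_single_mem hS x hij hy hz') _)
    -- Either the classes differ or both points are fixed by σ; in each case the block is constant.
    -- The all-ones matrix is the sum of all adjacency matrices.
    · have hleft : a (S.swap x y) z = a y z := by
        by_cases hyn : S.classOf x y = none
        · rw [classOf_eq_none_iff.1 hyn]
        · exact h2 _ _ fun h => hyz ⟨h, hyn⟩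
      have hright : a y (S.swap x z) = a y z := by
        rw [← hleft, ← h1, hS.swap_involutive x z]
      have key : S.dualIdempotent R x i * a * S.dualIdempotent R x j =
          a y z • (S.dualIdempotent R x i * (∑ l, S.adjMatrix R l) * S.dualIdempotent R x j) := by
        have hJ : ∀ u v, (∑ l, S.adjMatrix R l) u v = 1 := by
          intro u v
          simp [Matrix.sum_apply, adjMatrix, ← relIndex_eq_iff]
        ext u v
        rw [Matrix.smul_apply, dualIdempotent_mul_mul_apply, dualIdempotent_mul_mul_apply, hJ]
        by_cases huv : S.rel i x u ∧ S.rel j x v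
        · rw [if_pos huv, if_pos huv]
          rcases hcases hy huv.1 with rfl | rfl <;> rcases hcases hz huv.2 with rfl | rfl <;>
            simp [h1, hleft, hright]
        · simp [huv]
      rw [key]
      exact Subalgebra.smul_mem _ (mul_mem (mul_mem (dualIdempotent_mem x i)
        (sum_mem fun l _ => adjMatrix_mem x l)) (dualIdempotent_mem x j)) _

end Terwilliger

theorem relIndex_self (x : X) : S.relIndex x x = 0 :=
  relIndex_eq_iff.2 ((S.rel_zero x x).2 rfl)

theorem swap_self (x : X) : S.swap x x = x := by
  have h := S.rel_relIndex x (S.swap x x)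
  rw [relIndex_swap, relIndex_self, S.rel_zero] at h
  exact h.symm

theorem exists_classOf_eq_some (x : X) (q : Quotient S.setoid₂) :
    ∃ y, S.swap x y ≠ y ∧ S.classOf x y = some q := by
  obtain ⟨i, rfl⟩ := Quotient.exists_rep q
  obtain ⟨y, hy⟩ := S.exists_rel_of_valency_ne_zero (S.valency_ne_zero i) x
  exact ⟨y, S.swap_ne_iff.2 (by rw [relIndex_eq_iff.2 hy, i.2]), classOf_eq_some i hy⟩

/-- With at most one class, two points of different `classOf` include a fixed point of σ, so the row
condition follows from the simultaneous one. -/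
theorem mem_terwilligerAlgebra_iff_of_subsingleton [DecidableEq X] {R : Type*} [Field R]
    [Subsingleton (Quotient S.setoid₂)] (hS : S.IsQuasiThin) (x : X) (a : Matrix X X R) :
    a ∈ S.terwilligerAlgebra R x ↔ ∀ y z, a (S.swap x y) (S.swap x z) = a y z := by
  rw [mem_terwilligerAlgebra_iff hS, and_iff_left_iff_imp]
  intro h y z hyz
  match hy : S.classOf x y, hz : S.classOf x z with
  | none, _ => rw [classOf_eq_none_iff.1 hy]
  | some _, none => rw [← h y z, classOf_eq_none_iff.1 hz]
  | some q, some q' => exact absurd (by rw [hy, hz, Subsingleton.elim q q']) hyz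

end AssociationScheme

theorem corollary2p12 {X : Type*} [Fintype X] [DecidableEq X] {d : ℕ}
    (S : AssociationScheme X d) (hS : S.IsQuasiThin)
    {R : Type*} [Field R] (p : ℕ) [CharP R p] (x : X)
    (r : ℕ) (hr : S.numClasses = r) :
    HasDominantDimension (S.terwilligerAlgebra R x)
      (if p = 2 ∧ 2 ≤ r then 0 else if p = 2 ∧ r = 1 then 2 else ⊤) := by
  have hfin : Finite (Quotient S.setoid₂) := inferInstance
  split_ifs with h0 h1
  · obtain ⟨rfl, hr2⟩ := h0
    have : Nontrivial (Quotient S.setoid₂) :=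
      Finite.one_lt_card_iff_nontrivial.1 (by rw [AssociationScheme.numClasses] at hr; omega)
    obtain ⟨q, q', hq⟩ := exists_pair_ne (Quotient S.setoid₂)
    obtain ⟨y, hy, hyq⟩ := AssociationScheme.exists_classOf_eq_some x q
    obtain ⟨w, hw, hwq⟩ := AssociationScheme.exists_classOf_eq_some x q'
    exact hasDominantDimension_zero_of_swap (hS.swap_involutive x)
      (AssociationScheme.classOf_swap x) (AssociationScheme.mem_terwilligerAlgebra_iff hS x)
      (CharP.cast_eq_zero R 2) hy hw (AssociationScheme.swap_self x) (by simpa [hyq, hwq] using hq)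
  · obtain ⟨rfl, rfl⟩ := h1
    obtain ⟨_, ⟨q⟩⟩ := Nat.card_eq_one_iff_unique.1 hr
    obtain ⟨y, hy, -⟩ := AssociationScheme.exists_classOf_eq_some x q
    exact hasDominantDimension_two_of_swap (hS.swap_involutive x)
      (AssociationScheme.mem_terwilligerAlgebra_iff_of_subsingleton hS x)
      (CharP.cast_eq_zero R 2) hy (AssociationScheme.swap_self x)
  -- What remains is p ≠ 2 (including p = 0), where 2 is invertible, or p = 2 and r = 0, where no
  -- valency is 2 and σ is the identity.
  · have h2 : (2 : R) ≠ 0 ∨ ∀ y, S.swap x y = y := by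
      by_cases hp : p = 2
      · right
        have hr0 : S.numClasses = 0 := by
          subst hp
          simp only [true_and] at h0 h1
          omega
        have : IsEmpty (Quotient S.setoid₂) := Finite.card_eq_zero_iff.1 hr0
        intro y
        rw [← AssociationScheme.classOf_eq_none_iff]
        match h : S.classOf x y with
        | none => rfl
        | some q => exact isEmptyElim q
      · left
        intro h2
        have hdvd : p ∣ 2 := (CharP.cast_eq_zero_iff R p 2).1 (by exact_mod_cast h2)
        rcases (Nat.dvd_prime Nat.prime_two).1 hdvd with h | h
        · exact CharP.char_ne_one R p h
        · exact hp h
    have := isSemisimpleRing_of_swap (hS.swap_involutive x) (AssociationScheme.classOf_swap x)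
      (AssociationScheme.mem_terwilligerAlgebra_iff hS x) h2
    exact HasDominantDimension.of_isSemisimpleRing
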